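/- **Setting.** Fix $K\ge 1$ arms with laws $\mathcal P_1,\dots,\mathcal P_K$ on $\mathbb R$, with means $\mu_k$ and variances $\sigma_k^2$. Each arm is $\sigma$-subgaussian for a known $\sigma$, meaning $\mathbb E\,e^{t(X-\mu_k)}\le e^{\sigma^2t^2/2}$ for all $t\in\mathbb R$ when $X\sim\mathcal P_k$. Each arm is also strictly subgaussian, meaning that the same bound holds with $\sigma_k^2$ in place of $\sigma^2$. A number $\underline\sigma>0$ with $\underline\sigma^2\le\sigma_k^2$ for all $k$ is known. Let $X_{k,1},X_{k,2},\dots$ be the observations of arm $k$; for each $k$ they are i.i.d. with law $\mathcal P_k$ (no independence between different arms is needed). For $p\in(0,\infty]$ put $q=2p/(p+1)$ if $p<\infty$ and $q=2$ if $p=\infty$. For an allocation $\boldsymbol n=(n_1,\dots,n_K)$ let $$R_p(\boldsymbol n)=\Big(\sum_{k}(\sigma_k^2/n_k)^p\Big)^{1/p}\ (p<\infty),\qquad R_\infty(\boldsymbol n)=\max_k \sigma_k^2/n_k .$$ Let $\Sigma_r=\sum_k\sigma_k^r$, $\sigma_{\min}^2=\min_k\sigma_k^2$, $n_k^*=\sigma_k^q\,T/\Sigma_q$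 and $$\lambda=\frac{\underline\sigma^q}{\underline\sigma^q+(K-1)\sigma^q}.$$ **Algorithm** (horizon $T$). Let $\tau=\lfloor\lambda T\rfloor$. Phase 1: choose each arm $\tau$ times and let $\hat\sigma_{k,\tau}^2=\frac1{\tau-1}\sum_{i=1}^{\tau}(X_{k,i}-\bar X_{k,\tau})^2$, where $\bar X_{k,\tau}=\frac1\tau\sum_{i=1}^{\tau}X_{k,i}$. Phase 2: let $\lambda_{k,\tau}=\hat\sigma_{k,\tau}^q/\sum_j\hat\sigma_{j,\tau}^q$ (and $0$ if all $\hat\sigma_{j,\tau}$ vanish); for $k=1,\dots,K$ in turn choose arm $k$ for $\max(\lfloor\lambda_{k,\tau}T\rfloor-\tau,0)$ rounds, stopping as soon as $T$ rounds have been used in total. Let $\boldsymbol n_{\pi_1}$ be the resulting vector of numbers of times that the arms were chosen. **Theorem.** For every $T$, the random variable $R_p(\boldsymbol n_{\pi_1})-R_p(\boldsymbol n^*)$ is integrable (with the convention $x/0=0$, which matters only for finitely many $T$). With the arms, $\sigma$, $\underline\sigma$ and $p$ fixed, as $T\to\infty$: * if $p=\infty$, $$\mathbb E\big[R_\infty(\boldsymbol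 n_{\pi_1})-R_\infty(\boldsymbol n^*)\big]\le 4\lambda^{-1/2}\,(\Sigma_2-\sigma_{\min}^2)\,T^{-3/2}\sqrt{\log T}+o(T^{-3/2});$$ * if $0<p<\infty$, $$\mathbb E\big[R_p(\boldsymbol n_{\pi_1})-R_p(\boldsymbol n^*)\big]\le \frac{3p^2(\Sigma_q)^{2/q}}{\lambda(p+1)}\,T^{-2}\log T+o(T^{-2}).$$ -/

import Mathlib

open MeasureTheory ProbabilityTheory Filter Asymptotics
open scoped ENNReal NNReal

namespace MultiGroupMean

noncomputable section

/-- The exponent `q` attached to the norm `p`: `q = 2` for `p = ∞`, `q = 2p/(p+1)` otherwise. -/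
def qExp (p : ℝ≥0∞) : ℝ :=
  if p = ∞ then 2 else 2 * p.toReal / (p.toReal + 1)

/-- The standard deviation of a probability law on the real line. -/
def stdDev (P : Measure ℝ) : ℝ := √(Var[id; P])

/-- A law is `s`-subgaussian if its centred version satisfies
`E exp (t (X - E X)) ≤ exp (s² t² / 2)` for every real `t`. -/
def IsSubgaussian (P : Measure ℝ) (s : ℝ≥0) : Prop :=
  HasSubgaussianMGF (fun x => x - ∫ y, y ∂P) (s ^ 2) P

/-- A law is strictly subgaussian if it is `s`-subgaussian with `s²` equal to its variance. -/
def IsStrictlySubgaussian (P : Measure ℝ) : Prop :=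
  IsSubgaussian P (stdDev P).toNNReal

variable {K : ℕ}

/-- `Σ_r = ∑ₖ σₖ ^ r`. -/
def powSum (s : Fin K → ℝ) (r : ℝ) : ℝ := ∑ k, s k ^ r

/-- The smallest variance `σ_min²`. -/
def minVar (s : Fin K → ℝ) : ℝ := ⨅ k, s k ^ 2

/-- The objective `R_p(n)`: the `p`-norm of the vector of mean squared errors `σₖ² / nₖ`. -/
def objective (p : ℝ≥0∞) (s : Fin K → ℝ) (n : Fin K → ℝ) : ℝ :=
  if p = ∞ then ⨆ k, s k ^ 2 / n k
  else (∑ k, (s k ^ 2 / n k) ^ p.toReal) ^ (1 / p.toReal)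

/-- The weights `sₖ ^ q / ∑ⱼ sⱼ ^ q`. -/
def weight (q : ℝ) (s : Fin K → ℝ) (k : Fin K) : ℝ := s k ^ q / powSum s q

/-- The optimal allocation `n*` of `T` rounds when the standard deviations are known. -/
def optAlloc (p : ℝ≥0∞) (s : Fin K → ℝ) (T : ℕ) (k : Fin K) : ℝ := weight (qExp p) s k * T

/-- The sample mean of the first `n` terms. -/
def sampleMean (x : ℕ → ℝ) (n : ℕ) : ℝ := (∑ i ∈ Finset.range n, x i) / n

/-- The unbiased sample variance of the first `n` terms. -/
def sampleVar (x : ℕ → ℝ) (n : ℕ) : ℝ :=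
  (∑ i ∈ Finset.range n, (x i - sampleMean x n) ^ 2) / ((n : ℝ) - 1)

/-- `λ = a^q / (a^q + (K-1) s^q)`, where `a` is the known lower bound for the standard deviations
and `s` is the known subgaussian parameter. -/
def initFrac (K : ℕ) (q a s : ℝ) : ℝ := a ^ q / (a ^ q + ((K : ℝ) - 1) * s ^ q)

/-- Length `τ = ⌊λ T⌋` of the initial phase, per arm. -/
def initLen (K : ℕ) (q a s : ℝ) (T : ℕ) : ℕ := ⌊initFrac K q a s * T⌋₊

/-- The estimated weights, computed from the first `τ` observations of every arm;
`x k i` is the `i`-th observation (counted from `0`) of arm `k`. -/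
def estWeight (q : ℝ) (τ : ℕ) (x : Fin K → ℕ → ℝ) : Fin K → ℝ :=
  weight q (fun k => √(sampleVar (x k) τ))

/-- The number of rounds that phase 2 wants to give to arm `k`: `⌊λ_{k,τ} T⌋ - τ`, and none if this
is negative (subtraction of natural numbers). -/
def request (q : ℝ) (τ T : ℕ) (x : Fin K → ℕ → ℝ) (k : Fin K) : ℕ :=
  ⌊estWeight q τ x k * T⌋₊ - τ

/-- The number of times arm `k` is chosen by the non-adaptive allocation algorithm with initial
length `τ` and horizon `T`. Phase 1 chooses every arm `τ` times; phase 2 goes through the arms in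
order, chooses arm `k` for `request k` rounds, and ends when the horizon is reached, i.e. when
`T - K τ` rounds of phase 2 have been used. -/
def numPulls (q : ℝ) (τ T : ℕ) (x : Fin K → ℕ → ℝ) (k : Fin K) : ℕ :=
  τ + min (request q τ T x k) (T - K * τ - ∑ j ∈ Finset.Iio k, request q τ T x j)

/-- The optimality gap `R_p(n) - R_p(n*)` of the algorithm run on the observations `x`, for arms
with standard deviations `s`, known lower bound `a` and known subgaussian parameter `σ`. -/
def gap (p : ℝ≥0∞) (s : Fin K → ℝ) (a σ : ℝ) (T : ℕ) (x : Fin K → ℕ → ℝ) : ℝ :=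
  objective p s
      (fun k => (numPulls (qExp p) (initLen K (qExp p) a σ T) T x k : ℝ))
    - objective p s (optAlloc p s T)

end

end MultiGroupMean

/-! The logarithms in the statement leave room: the expected gap is in fact `O(T ^ (-3/2))` for `p =
∞` and `O(T ^ (-2))` for `p < ∞`. The remainder can therefore be taken to be zero, since a positive
multiple of `√(log T)` or `log T` eventually exceeds any constant. Only for `p = ∞`, `K = 1` is the
coefficient zero, and there the gap vanishes identically (`gap_of_one`).

By homogeneity (`gap_eq`) the gap is `1 / T` times the loss of the fractions `u = n / T` against the
optimal weights `w`. Let `e` be the largest error of the sample variances after phase 1. Since `λ ≤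
w k`, phase 1 overshoots no arm, and `exists_alloc_bounds` gives `|u k - w k| = O(e + 1/T)` and `0 ≤
1 - ∑ u k = O(e² + 1/T)`. For `p = ∞` the objective is Lipschitz, so the loss is `O(e + 1/T)`. For
`p < ∞` the point `w` is critical on the simplex, so the loss is bounded by the unused fraction plus
squared deviations, `O(e² + 1/T)` (`exists_objective_sub_le`).

Finally `E e² = O(1/T)`, because `τ` is proportional to `T` and the sample variance of subgaussian
data has mean squared error `O(1/n)` (`exists_integral_sampleVar_sub_sq_le`). -/

namespace MultiGroupMean

/-! ### Moments of subgaussian variables. -/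

/-- A quadratic lower bound for `2 cosh x`. -/
lemma two_add_sq_le_exp_add_exp_neg (x : ℝ) : 2 + x ^ 2 ≤ Real.exp x + Real.exp (-x) := by
  have h1 : Real.exp x + Real.exp (-x) = 2 * Real.cosh (2 * (x / 2)) := by
    rw [Real.cosh_eq]; ring_nf
  have h2 : (x / 2) ^ 2 ≤ Real.sinh (x / 2) ^ 2 := by
    rcases le_total 0 (x / 2) with h | h
    · exact pow_le_pow_left₀ h (Real.self_le_sinh_iff.2 h) 2
    · have := Real.sinh_le_self_iff.2 h
      nlinarith
  rw [h1, Real.cosh_two_mul, Real.cosh_sq]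
  linarith

lemma pow_four_le_exp_add_exp_neg (x : ℝ) : x ^ 4 ≤ 24 * (Real.exp x + Real.exp (-x)) := by
  have h := Real.pow_div_factorial_le_exp |x| (abs_nonneg x) 4
  have h2 : |x| ^ 4 = x ^ 4 := by rw [pow_abs, abs_of_nonneg (by positivity)]
  have h3 : Real.exp |x| ≤ Real.exp x + Real.exp (-x) := by
    rcases abs_choice x with h | h <;> rw [h] <;>
      linarith [Real.exp_pos x, Real.exp_pos (-x)]
  rw [h2, show (Nat.factorial 4 : ℝ) = 24 by norm_num [Nat.factorial]] at h
  linarith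

variable {Ω : Type*} [MeasurableSpace Ω] {μ : Measure Ω}

/-- The fourth moment of a subgaussian variable is bounded in terms of its parameter. -/
lemma integral_pow_four_le_of_hasSubgaussianMGF {Y : Ω → ℝ} {c : ℝ≥0}
    (h : HasSubgaussianMGF Y c μ) : ∫ ω, Y ω ^ 4 ∂μ ≤ 48 * Real.exp (c / 2) := by
  have i1 := h.integrable_exp_mul 1
  have i2 := h.integrable_exp_mul (-1)
  have m1 := h.mgf_le 1
  have m2 := h.mgf_le (-1)
  simp only [mgf, one_mul, neg_one_mul, one_pow, mul_one, even_two.neg_pow] at i1 i2 m1 m2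
  have hle : ∫ ω, Y ω ^ 4 ∂μ ≤ ∫ ω, 24 * (Real.exp (Y ω) + Real.exp (-Y ω)) ∂μ :=
    integral_mono_of_nonneg (ae_of_all _ fun ω => by positivity) ((i1.add i2).const_mul 24)
      (ae_of_all _ fun ω => pow_four_le_exp_add_exp_neg _)
  rw [integral_const_mul, integral_add i1 i2] at hle
  linarith

/-- The second moment of a subgaussian variable is at most its parameter. -/
lemma integral_sq_le_of_hasSubgaussianMGF [IsProbabilityMeasure μ] {Y : Ω → ℝ} {c : ℝ≥0}
    (h : HasSubgaussianMGF Y c μ) : ∫ ω, Y ω ^ 2 ∂μ ≤ c := by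
  -- Adding the MGF bounds at `t` and `-t` cancels the odd part. Dividing by `t²` and letting `t →
  -- 0` then compares the quadratic terms.
  have key : ∀ t : ℝ, 2 + t ^ 2 * ∫ ω, Y ω ^ 2 ∂μ ≤ 2 * Real.exp (c * t ^ 2 / 2) := by
    intro t
    have i1 := h.integrable_exp_mul t
    have i2 := h.integrable_exp_mul (-t)
    have m1 := h.mgf_le t
    have m2 := h.mgf_le (-t)
    have i3 : Integrable (fun ω => Y ω ^ 2) μ := (h.memLp 2).integrable_sq
    rw [even_two.neg_pow] at m2
    have hle : ∫ ω, (2 + t ^ 2 * Y ω ^ 2) ∂μ ≤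
        ∫ ω, (Real.exp (t * Y ω) + Real.exp (-t * Y ω)) ∂μ := by
      refine integral_mono ((integrable_const _).add (i3.const_mul _)) (i1.add i2) fun ω => ?_
      have := two_add_sq_le_exp_add_exp_neg (t * Y ω)
      simpa [mul_pow] using this
    rw [integral_add i1 i2, integral_add (integrable_const _) (i3.const_mul _),
      integral_const_mul] at hle
    simp only [integral_const, probReal_univ, smul_eq_mul, one_mul] at hle
    unfold mgf at m1 m2
    linarith
  set V := ∫ ω, Y ω ^ 2 ∂μ
  have hlim : Tendsto (fun n : ℕ => (c : ℝ) + c ^ 2 / 2 * (1 / ((n : ℝ) + 1))) atTop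
      (nhds ((c : ℝ) + c ^ 2 / 2 * 0)) :=
    tendsto_const_nhds.add (tendsto_one_div_add_atTop_nhds_zero_nat.const_mul _)
  rw [mul_zero, add_zero] at hlim
  refine ge_of_tendsto hlim ?_
  filter_upwards [eventually_ge_atTop ⌈(c : ℝ)⌉₊] with n hn
  -- Here `u = t²`. The bound `exp z ≤ 1 + z + z²` at `z = c u / 2` gives `V ≤ c + c² u / 2`.
  set u : ℝ := 1 / ((n : ℝ) + 1) with hu
  have hu0 : 0 < u := by positivity
  have hcn : (c : ℝ) ≤ n := (Nat.le_ceil _).trans (by exact_mod_cast hn)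
  have hcu : c * u / 2 ≤ 1 := by
    rw [hu, mul_one_div, div_div, div_le_one (by positivity)]
    linarith [(Nat.cast_nonneg n : (0 : ℝ) ≤ n)]
  have hk := key (√u)
  rw [Real.sq_sqrt hu0.le] at hk
  have hc0 : 0 ≤ c * u / 2 := by positivity
  have he := Real.abs_exp_sub_one_sub_id_le (x := c * u / 2) (by rwa [abs_of_nonneg hc0])
  have he2 := (abs_le.1 he).2
  have : u * V ≤ u * (c + c ^ 2 / 2 * u) := by nlinarith
  exact le_of_mul_le_mul_left this hu0

/-- The variance of a subgaussian law is at most the square of its parameter. -/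
lemma variance_le_of_isSubgaussian {P : Measure ℝ} [IsProbabilityMeasure P] {σ : ℝ≥0}
    (h : IsSubgaussian P σ) : Var[id; P] ≤ (σ : ℝ) ^ 2 := by
  rw [variance_eq_integral aemeasurable_id]
  simpa using integral_sq_le_of_hasSubgaussianMGF h

/-! ### Mean squared error of the sample variance. -/

/-- Centring at the true mean `m` makes the first sum a sum of independent terms, when the
observations are, and isolates the error of the sample mean in the second. -/
lemma sampleVar_eq (x : ℕ → ℝ) (m : ℝ) {n : ℕ} (hn : n ≠ 0) :
    sampleVar x n = (∑ i ∈ Finset.range n, (x i - m) ^ 2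
      - (∑ i ∈ Finset.range n, (x i - m)) ^ 2 / n) / ((n : ℝ) - 1) := by
  have hn' : (n : ℝ) ≠ 0 := by exact_mod_cast hn
  unfold sampleVar
  congr 1
  have hs : ∑ i ∈ Finset.range n, (x i - m) = n * (sampleMean x n - m) := by
    rw [Finset.sum_sub_distrib, sampleMean]
    simp
    field_simp
  have h1 : ∀ i, (x i - sampleMean x n) ^ 2 = (x i - m) ^ 2
      - 2 * (sampleMean x n - m) * (x i - m) + (sampleMean x n - m) ^ 2 := fun i => by ring
  rw [Finset.sum_congr rfl fun i _ => h1 i, Finset.sum_add_distrib, Finset.sum_sub_distrib,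
    ← Finset.mul_sum, hs, Finset.sum_const, Finset.card_range, nsmul_eq_mul]
  field_simp
  ring

lemma measurable_sampleVar (n : ℕ) : Measurable fun x : ℕ → ℝ => sampleVar x n := by
  unfold sampleVar sampleMean
  fun_prop

/-- The mean squared error of the sample variance of subgaussian observations is `O(1 / n)`. -/
lemma exists_integral_sampleVar_sub_sq_le [IsProbabilityMeasure μ] {P : Measure ℝ}
    [IsProbabilityMeasure P] {σ : ℝ≥0} (hσ : IsSubgaussian P σ) {X : ℕ → Ω → ℝ}
    (hlaw : ∀ t, HasLaw (X t) P μ) (hindep : iIndepFun X μ) :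
    ∃ C : ℝ, 0 ≤ C ∧ ∀ n : ℕ, 2 ≤ n →
      Integrable (fun ω => (sampleVar (fun t => X t ω) n - Var[id; P]) ^ 2) μ ∧
      ∫ ω, (sampleVar (fun t => X t ω) n - Var[id; P]) ^ 2 ∂μ ≤ C / n := by
  set m : ℝ := ∫ y, y ∂P with hm
  set V : ℝ := Var[id; P] with hV
  have hV0 : 0 ≤ V := variance_nonneg _ _
  have hg : ∀ t, HasSubgaussianMGF (fun ω => X t ω - m) (σ ^ 2) μ := by
    intro t
    refine HasSubgaussianMGF.of_map (X := fun x => x - m) (hlaw t).aemeasurable ?_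
    rw [(hlaw t).map_eq]
    exact hσ
  set U : ℕ → Ω → ℝ := fun t ω => (X t ω - m) ^ 2 with hU
  have hφ : Measurable fun x : ℝ => (x - m) ^ 2 := by fun_prop
  have hUL : ∀ t, MemLp (U t) 2 μ := by
    intro t
    refine (memLp_two_iff_integrable_sq
      ((hg t).aemeasurable.pow_const 2).aestronglyMeasurable).2 ?_
    have := ((hg t).memLp 4).integrable_norm_pow (p := 4) (by norm_num)
    refine this.congr (ae_of_all _ fun ω => ?_)
    simp only [Real.norm_eq_abs]
    rw [pow_abs, abs_of_nonneg (by positivity)]; ring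
  have hUmean : ∀ t, ∫ ω, U t ω ∂μ = V := by
    intro t
    have h1 := (hlaw t).integral_comp (f := fun x => (x - m) ^ 2) hφ.aestronglyMeasurable
    rw [hV, variance_eq_integral aemeasurable_id]
    exact h1
  set B : ℝ := Var[fun x : ℝ => (x - m) ^ 2; P] with hB
  have hB0 : 0 ≤ B := variance_nonneg _ _
  have hUvar : ∀ t, Var[U t; μ] = B := by
    intro t
    rw [hB, ← (hlaw t).map_eq, variance_map hφ.aemeasurable (hlaw t).aemeasurable]
    rfl
  set M : ℝ := 48 * Real.exp ((σ : ℝ) ^ 2 / 2) with hM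
  refine ⟨8 * (B + 2 * (M + V ^ 2)), by positivity, fun n hn => ?_⟩
  have hn0 : (0 : ℝ) < n := by positivity
  have hn2 : (2 : ℝ) ≤ n := by exact_mod_cast hn
  set A : Ω → ℝ := fun ω => ∑ i ∈ Finset.range n, U i ω with hA
  -- With the factor `1 / √n`, `S` is subgaussian with the parameter of a single observation, so its
  -- fourth moment is at most `M` for every `n`.
  set S : Ω → ℝ := fun ω => (√n)⁻¹ * ∑ i ∈ Finset.range n, (X i ω - m) with hS
  have hSg : HasSubgaussianMGF S (σ ^ 2) μ := by
    have h1 := HasSubgaussianMGF.sum_of_iIndepFun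
      (hindep.comp (fun _ x => x - m) fun _ => by fun_prop) (s := Finset.range n)
      (c := fun _ => σ ^ 2) (fun i _ => hg i)
    have h2 := h1.const_mul (√n)⁻¹
    change HasSubgaussianMGF S _ μ at h2
    convert h2 using 1
    rw [Finset.sum_const, Finset.card_range]
    refine NNReal.eq ?_
    change (σ : ℝ) ^ 2 = (√n)⁻¹ ^ 2 * ((n • σ ^ 2 : ℝ≥0) : ℝ)
    rw [inv_pow, Real.sq_sqrt hn0.le, NNReal.coe_nsmul, nsmul_eq_mul,
      inv_mul_cancel_left₀ hn0.ne', NNReal.coe_pow]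
  have hS4 := integral_pow_four_le_of_hasSubgaussianMGF hSg
  have hS4i : Integrable (fun ω => S ω ^ 4) μ := by
    have := (hSg.memLp 4).integrable_norm_pow (p := 4) (by norm_num)
    refine this.congr (ae_of_all _ fun ω => ?_)
    simp only [Real.norm_eq_abs]
    rw [pow_abs, abs_of_nonneg (by positivity)]
  have hAL : MemLp A 2 μ := memLp_finsetSum _ fun i _ => hUL i
  have hAm : ∫ ω, A ω ∂μ = n * V := by
    rw [hA, integral_finsetSum _ fun i _ => (hUL i).integrable (by norm_num)]
    simp [hUmean]
  have hAv : ∫ ω, (A ω - n * V) ^ 2 ∂μ = n * B := by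
    have h1 : Var[A; μ] = n * B := by
      have h2 := IndepFun.variance_sum (μ := μ) (X := U) (s := Finset.range n)
        (fun i _ => hUL i) (fun i _ j _ hij =>
          (hindep.comp (fun _ x => (x - m) ^ 2) fun _ => hφ).indepFun hij)
      simp only [hUvar, Finset.sum_const, Finset.card_range, nsmul_eq_mul] at h2
      rw [← h2]
      congr 1
      ext ω; simp [hA]
    rw [← h1, variance_eq_integral hAL.aemeasurable, hAm]
  have hAi : Integrable (fun ω => (A ω - n * V) ^ 2) μ :=
    (hAL.sub (memLp_const (n * V))).integrable_sq
  have hdom : Integrable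
      (fun ω => 8 / (n : ℝ) ^ 2 * ((A ω - n * V) ^ 2 + 2 * (S ω ^ 4 + V ^ 2))) μ :=
    (hAi.add ((hS4i.add (integrable_const _)).const_mul 2)).const_mul _
  have hbd : ∀ ω, (sampleVar (fun t => X t ω) n - V) ^ 2 ≤
      8 / (n : ℝ) ^ 2 * ((A ω - n * V) ^ 2 + 2 * (S ω ^ 4 + V ^ 2)) := by
    intro ω
    have hSS : (∑ i ∈ Finset.range n, (X i ω - m)) ^ 2 / n = S ω ^ 2 := by
      simp only [hS, mul_pow, inv_pow, Real.sq_sqrt hn0.le]; field_simp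
    have h1 : sampleVar (fun t => X t ω) n - V
        = ((A ω - n * V) - (S ω ^ 2 - V)) / ((n : ℝ) - 1) := by
      rw [sampleVar_eq _ m (by omega), hSS]
      have : (n : ℝ) - 1 ≠ 0 := by linarith
      field_simp
      ring
    rw [h1, div_pow, div_mul_eq_mul_div]
    have h3 : ((A ω - n * V) - (S ω ^ 2 - V)) ^ 2 ≤
        2 * ((A ω - n * V) ^ 2 + 2 * (S ω ^ 4 + V ^ 2)) := by
      nlinarith [sq_nonneg ((A ω - n * V) + (S ω ^ 2 - V)), sq_nonneg (S ω ^ 2 + V)]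
    -- This is `n ≤ 2 (n - 1)`, valid from `n = 2` on; with the factor `2` of `h3` it produces the
    -- `8`.
    have h4 : (n : ℝ) ^ 2 ≤ 4 * ((n : ℝ) - 1) ^ 2 := by nlinarith
    have h5 : 0 < ((n : ℝ) - 1) ^ 2 := by nlinarith
    rw [div_le_div_iff₀ h5 (by positivity)]
    calc _ ≤ (2 * ((A ω - n * V) ^ 2 + 2 * (S ω ^ 4 + V ^ 2))) * (4 * ((n : ℝ) - 1) ^ 2) := by
          gcongr
      _ = _ := by ring
  have hmeas : AEStronglyMeasurable
      (fun ω => (sampleVar (fun t => X t ω) n - V) ^ 2) μ := by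
    have hx : AEMeasurable (fun ω t => X t ω) μ :=
      aemeasurable_pi_lambda _ fun t => (hlaw t).aemeasurable
    exact (((measurable_sampleVar n).comp_aemeasurable hx).sub_const V).pow_const 2
      |>.aestronglyMeasurable
  refine ⟨hdom.mono' hmeas (ae_of_all _ fun ω => ?_), ?_⟩
  · rw [Real.norm_of_nonneg (sq_nonneg _)]; exact hbd ω
  · refine (integral_mono_of_nonneg (ae_of_all _ fun ω => sq_nonneg _) hdom
      (ae_of_all _ hbd)).trans ?_
    have hSV : Integrable (fun ω => S ω ^ 4 + V ^ 2) μ := hS4i.add (integrable_const _)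
    rw [integral_const_mul, integral_add hAi (hSV.const_mul 2),
      integral_const_mul, integral_add hS4i (integrable_const _), hAv]
    simp only [integral_const, probReal_univ, smul_eq_mul, one_mul]
    rw [div_mul_eq_mul_div, div_le_div_iff₀ (by positivity) hn0]
    have h6 : ∫ ω, S ω ^ 4 ∂μ ≤ M := by simpa using hS4
    have h7 : n * B + 2 * (∫ ω, S ω ^ 4 ∂μ + V ^ 2) ≤ n * (B + 2 * (M + V ^ 2)) := by
      nlinarith [sq_nonneg V, Real.exp_pos ((σ : ℝ) ^ 2 / 2)]
    nlinarith

/-! ### Serving requests from a budget. -/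

/-- The total granted when requests `r k` are served in order from a budget `M`. -/
lemma sum_min_sub_sum_Iio {K : ℕ} (r : Fin K → ℕ) (M : ℕ) :
    ∑ k, min (r k) (M - ∑ j ∈ Finset.Iio k, r j) = min (∑ k, r k) M := by
  induction K with
  | zero => simp
  | succ K ih =>
    have h1 : ∀ k : Fin K, ∑ j ∈ Finset.Iio k.castSucc, r j
        = ∑ j ∈ Finset.Iio k, r j.castSucc := by
      intro k
      rw [← Fin.map_castSuccEmb_Iio, Finset.sum_map]
      rfl
    have h2 : ∑ j ∈ Finset.Iio (Fin.last K), r j = ∑ j : Fin K, r j.castSucc := by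
      rw [Fin.Iio_last_eq_map, Finset.sum_map]
      rfl
    rw [Fin.sum_univ_castSucc, Fin.sum_univ_castSucc (f := r), h2]
    simp_rw [h1]
    rw [ih fun k => r k.castSucc]
    omega

/-! ### Regularity of the weights, and the initial fraction. -/

section Weight
variable {K : ℕ}

lemma powSum_pos [NeZero K] {s : Fin K → ℝ} (hs : ∀ k, 0 < s k) (q : ℝ) : 0 < powSum s q :=
  Finset.sum_pos (fun k _ => Real.rpow_pos_of_pos (hs k) q) ⟨0, Finset.mem_univ _⟩

lemma weight_nonneg {s : Fin K → ℝ} (hs : ∀ k, 0 ≤ s k) (q : ℝ) (k : Fin K) :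
    0 ≤ weight q s k :=
  div_nonneg (Real.rpow_nonneg (hs k) q)
    (Finset.sum_nonneg fun j _ => Real.rpow_nonneg (hs j) q)

lemma weight_le_one {s : Fin K → ℝ} (hs : ∀ k, 0 ≤ s k) (q : ℝ) (k : Fin K) :
    weight q s k ≤ 1 :=
  div_le_one_of_le₀
    (Finset.single_le_sum (f := fun j => s j ^ q) (fun j _ => Real.rpow_nonneg (hs j) q)
      (Finset.mem_univ k))
    (Finset.sum_nonneg fun j _ => Real.rpow_nonneg (hs j) q)

lemma weight_pos [NeZero K] {s : Fin K → ℝ} (hs : ∀ k, 0 < s k) (q : ℝ) (k : Fin K) :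
    0 < weight q s k :=
  div_pos (Real.rpow_pos_of_pos (hs k) q) (powSum_pos hs q)

lemma sum_weight {s : Fin K → ℝ} {q : ℝ} (h : powSum s q ≠ 0) : ∑ k, weight q s k = 1 := by
  simp only [weight, ← Finset.sum_div]
  exact div_self h

/-- The weights depend on the variances in a Lipschitz way around positive variances. -/
lemma exists_abs_weight_sqrt_sub_le {s : Fin K → ℝ} (hs : ∀ k, 0 < s k) (q : ℝ) :
    ∃ C : ℝ, 0 ≤ C ∧ ∀ (v : Fin K → ℝ) (k : Fin K),
      |weight q (fun j => √(v j)) k - weight q s k| ≤ C * ‖v - fun j => s j ^ 2‖ := by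
  set v₀ : Fin K → ℝ := fun j => s j ^ 2 with hv₀
  have hw₀ : ∀ k, weight q (fun j => √(v₀ j)) k = weight q s k := by
    intro k
    congr 1
    ext j
    exact Real.sqrt_sq (hs j).le
  have hone : ∀ k, ∃ C : ℝ, 0 ≤ C ∧ ∀ v : Fin K → ℝ,
      |weight q (fun j => √(v j)) k - weight q s k| ≤ C * ‖v - v₀‖ := by
    intro k
    have : NeZero K := ⟨by rintro rfl; exact k.elim0⟩
    have hd : DifferentiableAt ℝ (fun v : Fin K → ℝ => weight q (fun j => √(v j)) k) v₀ := by
      have hr : ∀ j, DifferentiableAt ℝ (fun v : Fin K → ℝ => √(v j) ^ q) v₀ := by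
        intro j
        have h1 : v₀ j ≠ 0 := (pow_pos (hs j) 2).ne'
        have h2 : DifferentiableAt ℝ (fun v : Fin K → ℝ => √(v j)) v₀ :=
          DifferentiableAt.sqrt (by fun_prop) h1
        exact h2.rpow_const (Or.inl (Real.sqrt_pos.2 (pow_pos (hs j) 2)).ne')
      unfold weight powSum
      simp_rw [div_eq_mul_inv]
      have hsum : DifferentiableAt ℝ (fun v : Fin K → ℝ => ∑ j, √(v j) ^ q) v₀ :=
        DifferentiableAt.fun_sum fun j _ => hr j
      refine (hr k).mul (hsum.inv ?_)
      exact (powSum_pos (fun j => Real.sqrt_pos.2 (pow_pos (hs j) 2)) q).ne'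
    -- Differentiability gives a linear bound only on a ball of radius `η`. Outside it the
    -- difference is at most `1 ≤ ‖v - v₀‖ / η`, because weights lie in `[0, 1]`.
    obtain ⟨c, hc⟩ := hd.hasFDerivAt.isBigO_sub.bound
    obtain ⟨η, hη, hball⟩ := Metric.eventually_nhds_iff.1 hc
    refine ⟨max |c| η⁻¹, by positivity, fun v => ?_⟩
    rcases lt_or_ge (dist v v₀) η with h | h
    · have := hball h
      rw [hw₀, Real.norm_eq_abs] at this
      refine this.trans ?_
      gcongr
      exact (le_abs_self c).trans (le_max_left _ _)
    · have h1 : |weight q (fun j => √(v j)) k - weight q s k| ≤ 1 := by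
        have a1 := weight_nonneg (fun j => Real.sqrt_nonneg (v j)) q k
        have a2 := weight_le_one (fun j => Real.sqrt_nonneg (v j)) q k
        have a3 := weight_nonneg (fun j => (hs j).le) q k
        have a4 := weight_le_one (fun j => (hs j).le) q k
        rw [abs_le]; constructor <;> linarith
      rw [dist_eq_norm] at h
      refine h1.trans ?_
      calc (1 : ℝ) = η⁻¹ * η := (inv_mul_cancel₀ hη.ne').symm
        _ ≤ max |c| η⁻¹ * ‖v - v₀‖ := by
          gcongr
          exact le_max_right _ _
  choose C hC0 hC using hone
  refine ⟨∑ k, C k, Finset.sum_nonneg fun k _ => hC0 k, fun v k => (hC k v).trans ?_⟩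
  gcongr
  exact Finset.single_le_sum (f := C) (fun j _ => hC0 j) (Finset.mem_univ k)

lemma initFrac_pos {K : ℕ} (hK : 1 ≤ K) {q a s : ℝ} (ha : 0 < a) (hs : 0 ≤ s) :
    0 < initFrac K q a s := by
  have h1 : (1 : ℝ) ≤ K := by exact_mod_cast hK
  have h2 := Real.rpow_pos_of_pos ha q
  have h3 := Real.rpow_nonneg hs q
  exact div_pos h2 (by nlinarith)

/-- The initial fraction is at most each of the optimal weights. -/
lemma initFrac_le_weight {q a σ : ℝ} (hq : 0 ≤ q) (ha : 0 < a) {s : Fin K → ℝ}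
    (hlow : ∀ k, a ≤ s k) (hup : ∀ k, s k ≤ σ) (k : Fin K) :
    initFrac K q a σ ≤ weight q s k := by
  have hK : (1 : ℝ) ≤ K := by exact_mod_cast Nat.one_le_iff_ne_zero.2 (by rintro rfl; exact k.elim0)
  have hs : ∀ k, 0 < s k := fun k => ha.trans_le (hlow k)
  have : NeZero K := ⟨by rintro rfl; exact k.elim0⟩
  have h1 : a ^ q ≤ s k ^ q := Real.rpow_le_rpow ha.le (hlow k) hq
  have h0 := Real.rpow_pos_of_pos ha q
  have hσ0 : 0 ≤ σ ^ q := Real.rpow_nonneg ((hs k).le.trans (hup k)) q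
  have h2 : powSum s q ≤ s k ^ q + ((K : ℝ) - 1) * σ ^ q := by
    unfold powSum
    rw [← Finset.add_sum_erase _ _ (Finset.mem_univ k)]
    gcongr
    refine (Finset.sum_le_card_nsmul _ _ (σ ^ q) fun j _ =>
      Real.rpow_le_rpow (hs j).le (hup j) hq).trans ?_
    rw [Finset.card_erase_of_mem (Finset.mem_univ k), Finset.card_univ, Fintype.card_fin,
      nsmul_eq_mul, Nat.cast_sub (by exact_mod_cast hK), Nat.cast_one]
  unfold initFrac weight
  rw [div_le_div_iff₀ (by nlinarith) (powSum_pos hs q)]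
  calc a ^ q * powSum s q ≤ a ^ q * (s k ^ q + ((K : ℝ) - 1) * σ ^ q) := by gcongr
    _ ≤ s k ^ q * (a ^ q + ((K : ℝ) - 1) * σ ^ q) := by
      nlinarith [mul_le_mul_of_nonneg_right h1 (mul_nonneg (sub_nonneg.2 hK) hσ0)]

end Weight

/-! ### From estimated weights to numbers of pulls. -/

section Alloc
variable {K : ℕ}

lemma sum_numPulls (q : ℝ) (τ T : ℕ) (x : Fin K → ℕ → ℝ) :
    ∑ k, numPulls q τ T x k = K * τ + min (∑ k, request q τ T x k) (T - K * τ) := by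
  simp only [numPulls]
  rw [Finset.sum_add_distrib, sum_min_sub_sum_Iio]
  simp

lemma sum_numPulls_le (q : ℝ) {τ T : ℕ} (h : K * τ ≤ T) (x : Fin K → ℕ → ℝ) :
    ∑ k, numPulls q τ T x k ≤ T := by
  rw [sum_numPulls]; omega

/-- Reaching the horizon early only removes rounds, so an upper bound for one arm does not depend on
the other requests. -/
lemma numPulls_le_of_le (q : ℝ) {τ T : ℕ} (x : Fin K → ℕ → ℝ) {k : Fin K} {b : ℝ}
    (hτ : (τ : ℝ) ≤ b) (h : estWeight q τ x k * T ≤ b) : (numPulls q τ T x k : ℝ) ≤ b := by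
  have h0 : 0 ≤ estWeight q τ x k * T :=
    mul_nonneg (weight_nonneg (fun j => Real.sqrt_nonneg _) q k) (Nat.cast_nonneg T)
  have h1 : numPulls q τ T x k ≤ max τ ⌊estWeight q τ x k * T⌋₊ := by
    unfold numPulls request; omega
  have h2 : (numPulls q τ T x k : ℝ) ≤ max (τ : ℝ) ⌊estWeight q τ x k * T⌋₊ := by
    exact_mod_cast h1
  exact h2.trans (max_le hτ ((Nat.floor_le h0).trans h))

/-- At most `K` rounds are left unused when the estimated weights add up to one. -/
lemma sub_le_sum_numPulls (q : ℝ) {τ T : ℕ} (h : K * τ ≤ T) (x : Fin K → ℕ → ℝ)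
    (hsum : ∑ k, estWeight q τ x k = 1) :
    (T : ℝ) - K ≤ ∑ k, (numPulls q τ T x k : ℝ) := by
  have h1 : ∑ k, ⌊estWeight q τ x k * T⌋₊ ≤ K * τ + ∑ k, request q τ T x k := by
    have : K * τ = ∑ _k : Fin K, τ := by simp
    rw [this, ← Finset.sum_add_distrib]
    refine Finset.sum_le_sum fun k _ => ?_
    unfold request; omega
  have h2 : (T : ℝ) - K ≤ ∑ k, (⌊estWeight q τ x k * T⌋₊ : ℝ) := by
    have : (T : ℝ) - K = ∑ k, (estWeight q τ x k * T - 1) := by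
      rw [Finset.sum_sub_distrib, ← Finset.sum_mul, hsum]; simp
    rw [this]
    exact Finset.sum_le_sum fun k _ => (Nat.sub_one_lt_floor _).le
  -- Either all requests are served, and the total is at least the sum of the floors, or the horizon
  -- is reached and the total is `T`.
  have h3 : min (∑ k, ⌊estWeight q τ x k * T⌋₊) T ≤ ∑ k, numPulls q τ T x k := by
    rw [sum_numPulls]; omega
  rcases min_choice (∑ k, ⌊estWeight q τ x k * T⌋₊) T with hm | hm <;> rw [hm] at h3
  · exact h2.trans (by exact_mod_cast h3)
  · have : (T : ℝ) ≤ ∑ k, (numPulls q τ T x k : ℝ) := by exact_mod_cast h3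
    linarith [(Nat.cast_nonneg K : (0 : ℝ) ≤ K)]

/-- The fractions of rounds chosen by the algorithm are close to the optimal weights when the
sample variances are close to the variances. -/
lemma exists_alloc_bounds [NeZero K] {s : Fin K → ℝ} (hs : ∀ k, 0 < s k) {q : ℝ} (hq : q ≠ 0) :
    ∃ C : ℝ, 0 ≤ C ∧ ∀ (τ T : ℕ) (x : Fin K → ℕ → ℝ), 1 ≤ T → K * τ ≤ T →
      (∀ k, (τ : ℝ) ≤ weight q s k * T) →
      (∀ k, |(numPulls q τ T x k : ℝ) / T - weight q s k| ≤
        C * (‖(fun k => sampleVar (x k) τ) - fun k => s k ^ 2‖ + 1 / T)) ∧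
      ∑ k, (numPulls q τ T x k : ℝ) / T ≤ 1 ∧
      1 - ∑ k, (numPulls q τ T x k : ℝ) / T ≤
        C * (‖(fun k => sampleVar (x k) τ) - fun k => s k ^ 2‖ ^ 2 + 1 / T) := by
  obtain ⟨C, hC0, hC⟩ := exists_abs_weight_sqrt_sub_le hs q
  set b : ℝ := s 0 ^ 2 with hb
  have hb0 : 0 < b := pow_pos (hs 0) 2
  -- The term `K * (C + 1)` serves the regular case; `1 / b` and `1 / b ^ 2` serve the case where
  -- all estimates vanish.
  refine ⟨K * (C + 1) + 1 / b + 1 / b ^ 2, by positivity, fun τ T x hT hKT hτ => ?_⟩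
  have hT0 : (0 : ℝ) < T := by exact_mod_cast hT
  set e : ℝ := ‖(fun k => sampleVar (x k) τ) - fun k => s k ^ 2‖ with he
  have he0 : 0 ≤ e := norm_nonneg _
  have hKr : (1 : ℝ) ≤ K := by exact_mod_cast Nat.one_le_iff_ne_zero.2 (NeZero.ne K)
  have hle : ∑ k, (numPulls q τ T x k : ℝ) ≤ T := by exact_mod_cast sum_numPulls_le q hKT x
  have hle1 : ∑ k, (numPulls q τ T x k : ℝ) / T ≤ 1 := by
    rw [← Finset.sum_div]; exact div_le_one_of_le₀ hle hT0.le
  have hT1 : 0 < 1 / (T : ℝ) := by positivity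
  have hwsum : ∑ k, weight q s k = 1 := sum_weight (powSum_pos hs q).ne'
  -- If every estimated deviation is zero, the estimated weights are `0` instead of summing to one.
  -- Then `e ≥ b`, so the trivial bound `1` on all quantities is already `O(e)` and `O(e²)`.
  by_cases hz : powSum (fun k => √(sampleVar (x k) τ)) q = 0
  · have hv : sampleVar (x 0) τ ≤ 0 := by
      have h1 := (Finset.sum_eq_zero_iff_of_nonneg fun j _ =>
        Real.rpow_nonneg (Real.sqrt_nonneg (sampleVar (x j) τ)) q).1 hz 0 (Finset.mem_univ _)
      exact Real.sqrt_eq_zero'.1 ((Real.rpow_eq_zero (Real.sqrt_nonneg _) hq).1 h1)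
    have hbe : b ≤ e := by
      have h1 := norm_le_pi_norm ((fun k => sampleVar (x k) τ) - fun k => s k ^ 2) 0
      rw [Real.norm_eq_abs] at h1
      have h2 := neg_abs_le (((fun k => sampleVar (x k) τ) - fun k => s k ^ 2) 0)
      simp only [Pi.sub_apply] at h1 h2
      linarith
    have h1e : 1 ≤ 1 / b * e := by
      rw [one_div_mul_eq_div]; exact (one_le_div hb0).2 hbe
    have h2e : 1 ≤ 1 / b ^ 2 * e ^ 2 := by
      rw [one_div_mul_eq_div]; exact (one_le_div (by positivity)).2 (by gcongr)
    refine ⟨fun k => ?_, hle1, ?_⟩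
    · have h1 : (numPulls q τ T x k : ℝ) / T ≤ 1 :=
        (Finset.single_le_sum (f := fun k => (numPulls q τ T x k : ℝ) / T)
          (fun j _ => by positivity) (Finset.mem_univ k)).trans hle1
      have h2 : 0 ≤ (numPulls q τ T x k : ℝ) / T := by positivity
      have h3 := weight_nonneg (fun j => (hs j).le) q k
      have h4 := weight_le_one (fun j => (hs j).le) q k
      calc |(numPulls q τ T x k : ℝ) / T - weight q s k| ≤ 1 := by
            rw [abs_le]; constructor <;> linarith
        _ ≤ 1 / b * e := h1e
        _ ≤ _ := by
          gcongr
          · linarith [show 0 ≤ (K : ℝ) * (C + 1) by positivity,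
              show 0 ≤ 1 / b ^ 2 by positivity]
          · linarith
    · calc 1 - ∑ k, (numPulls q τ T x k : ℝ) / T ≤ 1 := by
            linarith [show 0 ≤ ∑ k, (numPulls q τ T x k : ℝ) / T from
              Finset.sum_nonneg fun j _ => by positivity]
        _ ≤ 1 / b ^ 2 * e ^ 2 := h2e
        _ ≤ _ := by
          gcongr
          · linarith [show 0 ≤ (K : ℝ) * (C + 1) by positivity,
              show 0 ≤ 1 / b by positivity]
          · linarith
  · have hlow := sub_le_sum_numPulls q hKT x (sum_weight hz)
    have hlow1 : 1 - K * (1 / (T : ℝ)) ≤ ∑ k, (numPulls q τ T x k : ℝ) / T := by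
      rw [← Finset.sum_div, le_div_iff₀ hT0]
      refine le_trans (le_of_eq ?_) hlow
      field_simp
    have hup : ∀ k, (numPulls q τ T x k : ℝ) / T - weight q s k ≤ C * e := by
      intro k
      have h1 := (abs_le.1 (hC (fun k => sampleVar (x k) τ) k)).2
      rw [sub_le_iff_le_add, div_le_iff₀ hT0]
      refine numPulls_le_of_le q x ((hτ k).trans ?_) ?_
      · gcongr
        have : 0 ≤ C * e := by positivity
        linarith
      · gcongr
        unfold estWeight
        linarith
    -- The order of service may cut an arm short, so the lower bound comes from the total: it misses
    -- at most `K` rounds, and the excess of the other arms is bounded by `hup`.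
    have hdown : ∀ k, -(K * (C * e + 1 / T)) ≤ (numPulls q τ T x k : ℝ) / T - weight q s k := by
      intro k
      have h1 : ∑ j ∈ Finset.univ.erase k, ((numPulls q τ T x j : ℝ) / T - weight q s j)
          ≤ K * (C * e) := by
        refine (Finset.sum_le_card_nsmul _ _ _ fun j _ => hup j).trans ?_
        rw [nsmul_eq_mul]
        gcongr
        refine (Finset.card_le_univ _).trans ?_
        simp
      have h2 := Finset.add_sum_erase Finset.univ
        (fun j => (numPulls q τ T x j : ℝ) / T - weight q s j) (Finset.mem_univ k)
      have h3 : ∑ j, ((numPulls q τ T x j : ℝ) / T - weight q s j)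
          = ∑ j, (numPulls q τ T x j : ℝ) / T - 1 := by rw [Finset.sum_sub_distrib, hwsum]
      linarith
    have hc1 : (K : ℝ) * (C + 1) ≤ K * (C + 1) + 1 / b + 1 / b ^ 2 := by
      have : 0 ≤ 1 / b := by positivity
      have : 0 ≤ 1 / b ^ 2 := by positivity
      linarith
    refine ⟨fun k => ?_, hle1, ?_⟩
    · refine le_trans (b := K * (C + 1) * (e + 1 / T)) ?_ (by gcongr)
      have hKC : 0 ≤ K * C * (1 / (T : ℝ)) := by positivity
      have hKe : 0 ≤ K * e := by positivity
      have hCe : C * e ≤ K * (C * e) := le_mul_of_one_le_left (by positivity) hKr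
      have hK1 : 0 ≤ K * (1 / (T : ℝ)) := by positivity
      rw [abs_le]
      constructor
      · linarith [hdown k]
      · linarith [hup k]
    · refine le_trans (b := K * (C + 1) * (e ^ 2 + 1 / T)) ?_ (by gcongr)
      have hKC : 0 ≤ K * C * (1 / (T : ℝ)) := by positivity
      have hKe : 0 ≤ K * (C + 1) * e ^ 2 := by positivity
      linarith

end Alloc

/-! ### One-variable inequalities for exponentials and powers. -/

section Analysis

lemma abs_exp_sub_one_le_mul_exp_abs (z : ℝ) : |Real.exp z - 1| ≤ |z| * Real.exp |z| := by
  have h1 := Real.add_one_le_exp (-z)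
  have h2 := Real.add_one_le_exp z
  have h3 : Real.exp z * Real.exp (-z) = 1 := by rw [← Real.exp_add]; simp
  have h4 := Real.exp_pos z
  rcases le_total 0 z with h | h
  · rw [abs_of_nonneg h, abs_of_nonneg (by linarith)]
    nlinarith
  · rw [abs_of_nonpos h, abs_of_nonpos (by linarith [Real.exp_le_one_iff.2 h])]
    have : 1 ≤ Real.exp (-z) := by linarith
    nlinarith

/-- Multiplying `1 - z ≤ exp (-z)` by `exp z` gives `exp z - 1 ≤ z + z (exp z - 1)`, and the last
product is of second order. -/
lemma exp_le_one_add_add_sq_mul_exp_abs (z : ℝ) :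
    Real.exp z ≤ 1 + z + z ^ 2 * Real.exp |z| := by
  have h1 := Real.add_one_le_exp (-z)
  have h3 : Real.exp z * Real.exp (-z) = 1 := by rw [← Real.exp_add]; simp
  have h4 := Real.exp_pos z
  have h5 : Real.exp z - 1 ≤ z * Real.exp z := by nlinarith
  have h6 : z * (Real.exp z - 1) ≤ |z| * (|z| * Real.exp |z|) :=
    (le_abs_self _).trans (by
      rw [abs_mul]
      exact mul_le_mul_of_nonneg_left (abs_exp_sub_one_le_mul_exp_abs z) (abs_nonneg z))
  have h7 : |z| * (|z| * Real.exp |z|) = z ^ 2 * Real.exp |z| := by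
    rw [← mul_assoc, abs_mul_abs_self, sq]
  linarith

/-- A second order upper bound for `x ^ (-p)` around `1`, on an interval away from `0`. -/
lemma exists_rpow_neg_le {p m M : ℝ} (hp : 0 < p) (hm : 0 < m) (hM : 0 ≤ M) :
    ∃ C : ℝ, 0 ≤ C ∧ ∀ x : ℝ, m ≤ x → x ≤ M →
      x ^ (-p) ≤ 1 - p * (x - 1) + C * (x - 1) ^ 2 := by
  set D : ℝ := 1 + (M + 1) / m with hD
  have hD0 : 0 ≤ D := by positivity
  refine ⟨p / m + (p * D) ^ 2 * Real.exp (p * ((M + 1) * D)), by positivity, fun x hmx hxM => ?_⟩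
  have hx : 0 < x := hm.trans_le hmx
  set y : ℝ := x - 1 with hy
  have hyM : |y| ≤ M + 1 := by rw [abs_le]; constructor <;> linarith
  have hlog : -Real.log x ≤ -y + y ^ 2 / m := by
    -- Applying `log t ≤ t - 1` to `t = x⁻¹` bounds `-log x` from above with the correct linear
    -- term.
    have h1 := Real.log_le_sub_one_of_pos (inv_pos.2 hx)
    rw [Real.log_inv] at h1
    have h2 : x⁻¹ - 1 = -y + y ^ 2 / x := by rw [hy]; field_simp; ring
    have h3 : y ^ 2 / x ≤ y ^ 2 / m := div_le_div_of_nonneg_left (sq_nonneg y) hm hmx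
    linarith
  set z : ℝ := p * (-y + y ^ 2 / m) with hz
  have hzf : z = y * (p * (-1 + y / m)) := by rw [hz]; field_simp
  have hfac : |p * (-1 + y / m)| ≤ p * D := by
    rw [abs_mul, abs_of_pos hp]
    gcongr
    refine (abs_add_le _ _).trans ?_
    rw [abs_neg, abs_one, abs_div, abs_of_pos hm, hD]
    gcongr
  have hzabs : |z| ≤ p * ((M + 1) * D) := by
    rw [hzf, abs_mul]
    calc |y| * |p * (-1 + y / m)| ≤ (M + 1) * (p * D) := by gcongr
      _ = _ := by ring
  have hzsq : z ^ 2 ≤ (p * D) ^ 2 * y ^ 2 := by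
    rw [hzf, mul_pow, mul_comm]
    exact mul_le_mul_of_nonneg_right (sq_le_sq' (abs_le.1 hfac).1 (abs_le.1 hfac).2)
      (sq_nonneg y)
  calc x ^ (-p) = Real.exp (p * -Real.log x) := by
        rw [Real.rpow_def_of_pos hx]; congr 1; ring
    _ ≤ Real.exp z := Real.exp_le_exp.2 (mul_le_mul_of_nonneg_left hlog hp.le)
    _ ≤ 1 + z + z ^ 2 * Real.exp |z| := exp_le_one_add_add_sq_mul_exp_abs z
    _ ≤ 1 + z + (p * D) ^ 2 * y ^ 2 * Real.exp (p * ((M + 1) * D)) := by gcongr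
    _ = _ := by rw [hz]; ring

/-- An upper Lipschitz bound for real powers on bounded sets. -/
lemma exists_rpow_sub_rpow_le {r A M : ℝ} (hr : 0 < r) (hA : 0 < A) :
    ∃ C : ℝ, 0 ≤ C ∧ ∀ x B : ℝ, 0 ≤ x → x ≤ M → 0 ≤ B → x - A ≤ B →
      x ^ r - A ^ r ≤ C * B := by
  refine ⟨A ^ r * (r / A * Real.exp (r * |M / A - 1|)), by positivity,
    fun x B hx0 hxM hB hxA => ?_⟩
  -- Below `A` the left side is nonpositive, so only `x ≥ A` needs an estimate.
  rcases le_total x A with h | h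
  · have := Real.rpow_le_rpow hx0 h hr.le
    have h2 : 0 ≤ A ^ r * (r / A * Real.exp (r * |M / A - 1|)) * B := by positivity
    linarith
  · set y : ℝ := x / A with hy
    have hy1 : 1 ≤ y := (one_le_div hA).2 h
    have hxy : x = A * y := by rw [hy]; field_simp
    have h1 : y ^ r ≤ Real.exp (r * (y - 1)) := by
      rw [Real.rpow_def_of_pos (by linarith)]
      refine Real.exp_le_exp.2 ?_
      rw [mul_comm]
      exact mul_le_mul_of_nonneg_left (Real.log_le_sub_one_of_pos (by linarith)) hr.le
    have hz0 : 0 ≤ r * (y - 1) := mul_nonneg hr.le (by linarith)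
    have h2 := (le_abs_self _).trans (abs_exp_sub_one_le_mul_exp_abs (r * (y - 1)))
    rw [abs_of_nonneg hz0] at h2
    have h3 : r * (y - 1) ≤ r * |M / A - 1| := by
      gcongr
      refine le_trans ?_ (le_abs_self _)
      rw [hy]; gcongr
    have h4 : r * (y - 1) ≤ r / A * B := by
      have : y - 1 = (x - A) / A := by rw [hy]; field_simp
      rw [this, mul_div_assoc', div_mul_eq_mul_div]
      gcongr
    rw [hxy, Real.mul_rpow hA.le (by linarith)]
    calc A ^ r * y ^ r - A ^ r = A ^ r * (y ^ r - 1) := by ring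
      _ ≤ A ^ r * (r * (y - 1) * Real.exp (r * (y - 1))) := by gcongr; linarith
      _ ≤ A ^ r * (r / A * B * Real.exp (r * |M / A - 1|)) := by gcongr
      _ = _ := by ring

end Analysis

/-! ### Sensitivity of the objective to the allocation. -/

section Objective
variable {K : ℕ}

/-- The objective is homogeneous of degree `-1`. -/
lemma objective_mul {p : ℝ≥0∞} (hp : p ≠ 0) (s : Fin K → ℝ) {u : Fin K → ℝ} (hu : ∀ k, 0 ≤ u k)
    {t : ℝ} (ht : 0 < t) : objective p s (fun k => u k * t) = objective p s u / t := by
  have h1 : ∀ k, s k ^ 2 / (u k * t) = s k ^ 2 / u k * t⁻¹ := fun k => by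
    rw [← div_div, div_eq_mul_inv]
  unfold objective
  simp_rw [h1]
  split_ifs with h
  · rw [← Real.iSup_mul_of_nonneg (inv_nonneg.2 ht.le), div_eq_mul_inv]
  · have hp0 : 0 < p.toReal := ENNReal.toReal_pos hp h
    have h2 : ∀ k, (s k ^ 2 / u k * t⁻¹) ^ p.toReal
        = (s k ^ 2 / u k) ^ p.toReal * t⁻¹ ^ p.toReal := fun k =>
      Real.mul_rpow (div_nonneg (sq_nonneg _) (hu k)) (inv_nonneg.2 ht.le)
    simp_rw [h2]
    rw [← Finset.sum_mul, Real.mul_rpow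
      (Finset.sum_nonneg fun k _ => Real.rpow_nonneg (div_nonneg (sq_nonneg _) (hu k)) _)
      (Real.rpow_nonneg (inv_nonneg.2 ht.le) _), ← Real.rpow_mul (inv_nonneg.2 ht.le),
      mul_one_div_cancel hp0.ne', Real.rpow_one, ← div_eq_mul_inv]

/-- Each `s k ^ 2 / x` is Lipschitz for `x ≥ m`, and a maximum inherits the bound. -/
lemma objective_top_sub_le [NeZero K] (s : Fin K → ℝ) {u w : Fin K → ℝ} {m B : ℝ} (hm : 0 < m)
    (hu : ∀ k, m ≤ u k) (hw : ∀ k, m ≤ w k) (huw : ∀ k, |u k - w k| ≤ B) :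
    objective ∞ s u - objective ∞ s w ≤ (∑ k, s k ^ 2) / m ^ 2 * B := by
  have hB : 0 ≤ B := (abs_nonneg _).trans (huw 0)
  unfold objective
  rw [if_pos rfl, if_pos rfl, sub_le_iff_le_add]
  refine ciSup_le fun k => ?_
  have h1 : s k ^ 2 / w k ≤ ⨆ k, s k ^ 2 / w k :=
    le_ciSup (f := fun k => s k ^ 2 / w k) (Set.finite_range _).bddAbove k
  have hu0 := hm.trans_le (hu k)
  have hw0 := hm.trans_le (hw k)
  have h2 : s k ^ 2 / u k - s k ^ 2 / w k = s k ^ 2 * ((w k - u k) / (u k * w k)) := by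
    field_simp
  have h3 : (w k - u k) / (u k * w k) ≤ B / m ^ 2 := by
    have : w k - u k ≤ B := by linarith [(abs_le.1 (huw k)).1]
    have h4 : m ^ 2 ≤ u k * w k := by
      rw [sq]; exact mul_le_mul (hu k) (hw k) hm.le hu0.le
    exact div_le_div₀ hB this (by positivity) h4
  have h5 : s k ^ 2 * ((w k - u k) / (u k * w k)) ≤ (∑ k, s k ^ 2) * (B / m ^ 2) := by
    refine (mul_le_mul_of_nonneg_left h3 (sq_nonneg _)).trans ?_
    gcongr
    exact Finset.single_le_sum (f := fun k => s k ^ 2) (fun j _ => sq_nonneg _)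
      (Finset.mem_univ k)
  have h6 : (∑ k, s k ^ 2) / m ^ 2 * B = (∑ k, s k ^ 2) * (B / m ^ 2) := by ring
  linarith

/-- The Lagrange condition: up to the factor `-p`, the left side is the derivative of `x ↦ (s k ^ 2
/ x) ^ p` at the weight, and `q` is the exponent that makes it independent of `k`. -/
lemma rpow_div_weight_div_weight [NeZero K] {p : ℝ} (hp : 0 < p) {s : Fin K → ℝ}
    (hs : ∀ k, 0 < s k) (k : Fin K) :
    (s k ^ 2 / weight (2 * p / (p + 1)) s k) ^ p / weight (2 * p / (p + 1)) s k
      = powSum s (2 * p / (p + 1)) ^ (p + 1) := by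
  set q := 2 * p / (p + 1) with hq
  have hw := weight_pos hs q k
  have hS := powSum_pos hs q
  have hsq := Real.rpow_pos_of_pos (hs k) q
  rw [Real.div_rpow (sq_nonneg _) hw.le, div_div, ← Real.rpow_add_one hw.ne',
    show weight q s k = s k ^ q / powSum s q from rfl, Real.div_rpow hsq.le hS.le,
    ← Real.rpow_mul (hs k).le, ← Real.rpow_natCast (s k) 2, ← Real.rpow_mul (hs k).le,
    show q * (p + 1) = ((2 : ℕ) : ℝ) * p by rw [hq]; push_cast; field_simp]
  have : 0 < s k ^ (((2 : ℕ) : ℝ) * p) := Real.rpow_pos_of_pos (hs k) _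
  field_simp

/-- The optimal weights are a critical point of the objective on the simplex, so the loss is of
second order in the deviation from them. -/
lemma exists_objective_sub_le [NeZero K] {p : ℝ≥0∞} (hp : p ≠ 0) (hpt : p ≠ ∞) {s : Fin K → ℝ}
    (hs : ∀ k, 0 < s k) {m : ℝ} (hm : 0 < m) :
    ∃ C : ℝ, 0 ≤ C ∧ ∀ u : Fin K → ℝ, (∀ k, m ≤ u k) → ∑ k, u k ≤ 1 →
      objective p s u - objective p s (weight (qExp p) s) ≤
        C * ((1 - ∑ k, u k) + ∑ k, (u k - weight (qExp p) s k) ^ 2) := by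
  set P := p.toReal with hP
  have hP0 : 0 < P := ENNReal.toReal_pos hp hpt
  have hqe : qExp p = 2 * P / (P + 1) := by unfold qExp; rw [if_neg hpt]
  set w := weight (qExp p) s with hwdef
  have hw : ∀ k, 0 < w k := weight_pos hs _
  have hwsum : ∑ k, w k = 1 := sum_weight (powSum_pos hs _).ne'
  have hw1 : ∀ k, w k ≤ 1 := weight_le_one (fun k => (hs k).le) _
  set Λ := powSum s (qExp p) ^ (P + 1) with hΛ
  have hΛ0 : 0 < Λ := Real.rpow_pos_of_pos (powSum_pos hs _) _
  have hcrit : ∀ k, (s k ^ 2 / w k) ^ P / w k = Λ := fun k => by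
    simp only [hwdef, hΛ, hqe]; exact rpow_div_weight_div_weight hP0 hs k
  -- Second-order expansion of each summand, with the same slope `-P Λ` for all arms.
  have hone : ∀ k, ∃ C : ℝ, 0 ≤ C ∧ ∀ x : ℝ, m ≤ x → x ≤ 1 →
      (s k ^ 2 / x) ^ P - (s k ^ 2 / w k) ^ P ≤ -(P * Λ * (x - w k)) + C * (x - w k) ^ 2 := by
    intro k
    obtain ⟨C, hC0, hC⟩ := exists_rpow_neg_le (M := 1 / w k) hP0 hm (by have := hw k; positivity)
    have hF0 : 0 < (s k ^ 2 / w k) ^ P :=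
      Real.rpow_pos_of_pos (div_pos (pow_pos (hs k) 2) (hw k)) _
    refine ⟨(s k ^ 2 / w k) ^ P * (C / w k ^ 2), by positivity, fun x hmx hx1 => ?_⟩
    have hx0 := hm.trans_le hmx
    have hwk := hw k
    have h1 := hC (x / w k)
      (hmx.trans (le_div_self hx0.le hwk (hw1 k))) (by gcongr)
    have h2 : (s k ^ 2 / x) ^ P = (s k ^ 2 / w k) ^ P * (x / w k) ^ (-P) := by
      rw [Real.rpow_neg (by positivity), ← Real.inv_rpow (by positivity), inv_div,
        ← Real.mul_rpow (by positivity) (by positivity)]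
      congr 1
      field_simp
    rw [h2, ← hcrit k]
    calc (s k ^ 2 / w k) ^ P * (x / w k) ^ (-P) - (s k ^ 2 / w k) ^ P
        ≤ (s k ^ 2 / w k) ^ P * (1 - P * (x / w k - 1) + C * (x / w k - 1) ^ 2)
          - (s k ^ 2 / w k) ^ P := by gcongr
      _ = _ := by field_simp; ring
  choose C hC0 hC using hone
  set F : (Fin K → ℝ) → ℝ := fun u => ∑ k, (s k ^ 2 / u k) ^ P with hF
  have hFw : 0 < F w := Finset.sum_pos
    (fun k _ => Real.rpow_pos_of_pos (div_pos (pow_pos (hs k) 2) (hw k)) _)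
    ⟨0, Finset.mem_univ _⟩
  obtain ⟨D, hD0, hD⟩ := exists_rpow_sub_rpow_le (r := 1 / P)
    (M := ∑ k, (s k ^ 2 / m) ^ P) (by positivity) hFw
  refine ⟨D * (P * Λ + ∑ k, C k),
    mul_nonneg hD0 (add_nonneg (by positivity) (Finset.sum_nonneg fun k _ => hC0 k)),
    fun u hu hu1 => ?_⟩
  have hu0 : ∀ k, 0 < u k := fun k => hm.trans_le (hu k)
  have hule : ∀ k, u k ≤ 1 := fun k =>
    (Finset.single_le_sum (f := u) (fun j _ => (hu0 j).le) (Finset.mem_univ k)).trans hu1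
  have hFu0 : 0 ≤ F u := Finset.sum_nonneg fun k _ =>
    Real.rpow_nonneg (div_nonneg (sq_nonneg _) (hu0 k).le) _
  have hFuM : F u ≤ ∑ k, (s k ^ 2 / m) ^ P := Finset.sum_le_sum fun k _ =>
    Real.rpow_le_rpow (div_nonneg (sq_nonneg _) (hu0 k).le)
      (div_le_div_of_nonneg_left (sq_nonneg _) hm (hu k)) hP0.le
  have hQ0 : 0 ≤ ∑ k, (u k - w k) ^ 2 := Finset.sum_nonneg fun k _ => sq_nonneg _
  have hCs0 : 0 ≤ ∑ k, C k := Finset.sum_nonneg fun k _ => hC0 k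
  have hdiff : F u - F w ≤ (P * Λ + ∑ k, C k) * ((1 - ∑ k, u k) + ∑ k, (u k - w k) ^ 2) := by
    have h1 : F u - F w ≤ P * Λ * (1 - ∑ k, u k) + ∑ k, C k * (u k - w k) ^ 2 := by
      -- As the slopes agree and `∑ w k = 1`, the linear terms collapse to a multiple of the unused
      -- fraction.
      have h2 : P * Λ * (1 - ∑ k, u k) + ∑ k, C k * (u k - w k) ^ 2
          = ∑ k, (-(P * Λ * (u k - w k)) + C k * (u k - w k) ^ 2) := by
        rw [Finset.sum_add_distrib, Finset.sum_neg_distrib, ← Finset.mul_sum,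
          Finset.sum_sub_distrib, hwsum]
        ring
      rw [h2, hF]
      simp only
      rw [← Finset.sum_sub_distrib]
      exact Finset.sum_le_sum fun k _ => hC k (u k) (hu k) (hule k)
    have h3 : ∑ k, C k * (u k - w k) ^ 2 ≤ (∑ k, C k) * ∑ k, (u k - w k) ^ 2 := by
      rw [Finset.mul_sum]
      refine Finset.sum_le_sum fun k _ => ?_
      gcongr
      exact Finset.single_le_sum (f := C) (fun j _ => hC0 j) (Finset.mem_univ k)
    have h4 : 0 ≤ P * Λ * ∑ k, (u k - w k) ^ 2 := by positivity
    have h5 : 0 ≤ (∑ k, C k) * (1 - ∑ k, u k) := mul_nonneg hCs0 (by linarith)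
    linarith
  have hB0 : 0 ≤ (P * Λ + ∑ k, C k) * ((1 - ∑ k, u k) + ∑ k, (u k - w k) ^ 2) :=
    mul_nonneg (add_nonneg (by positivity) hCs0) (add_nonneg (by linarith) hQ0)
  have := hD (F u) _ hFu0 hFuM hB0 hdiff
  unfold objective
  rw [if_neg hpt, if_neg hpt]
  exact this.trans_eq (by ring)

end Objective

/-! ### Pathwise bounds, measurability and boundedness of the gap. -/

section Gap
variable {K : ℕ}

lemma qExp_pos {p : ℝ≥0∞} (hp : p ≠ 0) : 0 < qExp p := by
  unfold qExp
  split_ifs with h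
  · norm_num
  · have := ENNReal.toReal_pos hp h
    positivity

lemma norm_sq_le_sum_sq (f : Fin K → ℝ) : ‖f‖ ^ 2 ≤ ∑ k, f k ^ 2 := by
  have h0 : 0 ≤ ∑ k, f k ^ 2 := Finset.sum_nonneg fun k _ => sq_nonneg _
  have h : ‖f‖ ≤ √(∑ k, f k ^ 2) := by
    refine (pi_norm_le_iff_of_nonneg (Real.sqrt_nonneg _)).2 fun k => ?_
    rw [Real.norm_eq_abs]
    exact Real.abs_le_sqrt
      (Finset.single_le_sum (f := fun k => f k ^ 2) (fun j _ => sq_nonneg _) (Finset.mem_univ k))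
  calc ‖f‖ ^ 2 ≤ √(∑ k, f k ^ 2) ^ 2 := by gcongr
    _ = _ := Real.sq_sqrt h0

lemma initLen_le {q a σ : ℝ} (h : 0 ≤ initFrac K q a σ) (T : ℕ) :
    (initLen K q a σ T : ℝ) ≤ initFrac K q a σ * T :=
  Nat.floor_le (mul_nonneg h (Nat.cast_nonneg T))

/-- Rounding down costs at most one round, hence at most half of `λ T`. This keeps the fractions of
all arms above `λ / 2`, away from the singularity of the objective at `0`. -/
lemma le_initLen {q a σ : ℝ} {T : ℕ} (hT : 2 ≤ initFrac K q a σ * T) :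
    initFrac K q a σ / 2 * T ≤ initLen K q a σ T := by
  have := Nat.sub_one_lt_floor (initFrac K q a σ * T)
  unfold initLen
  linarith

lemma mul_initLen_le [NeZero K] {q a σ : ℝ} {s : Fin K → ℝ} (hs : ∀ k, 0 < s k)
    (h0 : 0 ≤ initFrac K q a σ) (h : ∀ k, initFrac K q a σ ≤ weight q s k) (T : ℕ) :
    K * initLen K q a σ T ≤ T := by
  have h1 : (K : ℝ) * initLen K q a σ T ≤ T := by
    calc (K : ℝ) * initLen K q a σ T = ∑ _k : Fin K, (initLen K q a σ T : ℝ) := by simp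
      _ ≤ ∑ k : Fin K, weight q s k * T := Finset.sum_le_sum fun k _ =>
        (initLen_le h0 T).trans (mul_le_mul_of_nonneg_right (h k) (Nat.cast_nonneg T))
      _ = T := by rw [← Finset.sum_mul, sum_weight (powSum_pos hs q).ne', one_mul]
  exact_mod_cast h1

lemma gap_eq {p : ℝ≥0∞} (hp : p ≠ 0) {s : Fin K → ℝ} (hs : ∀ k, 0 < s k) (a σ : ℝ) {T : ℕ}
    (hT : 1 ≤ T) (x : Fin K → ℕ → ℝ) :
    gap p s a σ T x = (objective p s
        (fun k => (numPulls (qExp p) (initLen K (qExp p) a σ T) T x k : ℝ) / T)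
      - objective p s (weight (qExp p) s)) / T := by
  have hT0 : (0 : ℝ) < T := by exact_mod_cast hT
  rw [sub_div, ← objective_mul hp s (fun k => by positivity) hT0,
    ← objective_mul hp s (fun k => weight_nonneg (fun k => (hs k).le) _ k) hT0]
  simp_rw [div_mul_cancel₀ _ hT0.ne']
  rfl

/-- The gap for `p = ∞` is of first order in the errors of the sample variances. -/
lemma exists_gap_top_le [NeZero K] {s : Fin K → ℝ} {a σ : ℝ} (ha : 0 < a)
    (hlow : ∀ k, a ≤ s k) (hup : ∀ k, s k ≤ σ) :
    ∃ C : ℝ, 0 ≤ C ∧ ∀ (T : ℕ) (x : Fin K → ℕ → ℝ), 1 ≤ T →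
      2 ≤ initFrac K (qExp ∞) a σ * T →
      gap ∞ s a σ T x ≤ C / T *
        (‖(fun k => sampleVar (x k) (initLen K (qExp ∞) a σ T)) - fun k => s k ^ 2‖ + 1 / T) := by
  have hs : ∀ k, 0 < s k := fun k => ha.trans_le (hlow k)
  have hq := qExp_pos ENNReal.top_ne_zero
  have hK : 1 ≤ K := Nat.one_le_iff_ne_zero.2 (NeZero.ne K)
  have hlam := initFrac_pos hK (q := qExp ∞) ha ((hs 0).le.trans (hup 0))
  have hlw := initFrac_le_weight hq.le ha hlow hup
  obtain ⟨C, hC0, hC⟩ := exists_alloc_bounds hs hq.ne'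
  set lam := initFrac K (qExp ∞) a σ with hlamdef
  refine ⟨(∑ k, s k ^ 2) / (lam / 2) ^ 2 * C, by positivity, fun T x hT hT2 => ?_⟩
  have hT0 : (0 : ℝ) < T := by exact_mod_cast hT
  obtain ⟨h1, -, -⟩ := hC (initLen K (qExp ∞) a σ T) T x hT (mul_initLen_le hs hlam.le hlw T)
    fun k => (initLen_le hlam.le T).trans (mul_le_mul_of_nonneg_right (hlw k) hT0.le)
  rw [gap_eq ENNReal.top_ne_zero hs a σ hT, div_mul_eq_mul_div]
  refine div_le_div_of_nonneg_right ?_ hT0.le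
  rw [mul_assoc]
  refine objective_top_sub_le s (half_pos hlam) (fun k => ?_) (fun k => ?_) h1
  · rw [le_div_iff₀ hT0]
    exact (le_initLen hT2).trans (Nat.cast_le.2 (Nat.le_add_right _ _))
  · exact (half_le_self hlam.le).trans (hlw k)

/-- The gap for `p < ∞` is of second order in the errors of the sample variances. -/
lemma exists_gap_le [NeZero K] {p : ℝ≥0∞} (hp : p ≠ 0) (hpt : p ≠ ∞) {s : Fin K → ℝ} {a σ : ℝ}
    (ha : 0 < a) (hlow : ∀ k, a ≤ s k) (hup : ∀ k, s k ≤ σ) :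
    ∃ C : ℝ, 0 ≤ C ∧ ∀ (T : ℕ) (x : Fin K → ℕ → ℝ), 1 ≤ T →
      2 ≤ initFrac K (qExp p) a σ * T →
      gap p s a σ T x ≤ C / T *
        (‖(fun k => sampleVar (x k) (initLen K (qExp p) a σ T)) - fun k => s k ^ 2‖ ^ 2
          + 1 / T) := by
  have hs : ∀ k, 0 < s k := fun k => ha.trans_le (hlow k)
  have hq := qExp_pos hp
  have hK : 1 ≤ K := Nat.one_le_iff_ne_zero.2 (NeZero.ne K)
  have hlam := initFrac_pos hK (q := qExp p) ha ((hs 0).le.trans (hup 0))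
  have hlw := initFrac_le_weight hq.le ha hlow hup
  obtain ⟨C, hC0, hC⟩ := exists_alloc_bounds hs hq.ne'
  obtain ⟨D, hD0, hD⟩ := exists_objective_sub_le hp hpt hs (half_pos hlam)
  refine ⟨D * (C + K * (2 * C ^ 2)), by positivity, fun T x hT hT2 => ?_⟩
  have hT0 : (0 : ℝ) < T := by exact_mod_cast hT
  obtain ⟨h1, h2, h3⟩ := hC (initLen K (qExp p) a σ T) T x hT (mul_initLen_le hs hlam.le hlw T)
    fun k => (initLen_le hlam.le T).trans (mul_le_mul_of_nonneg_right (hlw k) hT0.le)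
  set e := ‖(fun k => sampleVar (x k) (initLen K (qExp p) a σ T)) - fun k => s k ^ 2‖
  rw [gap_eq hp hs a σ hT, div_mul_eq_mul_div]
  refine div_le_div_of_nonneg_right ?_ hT0.le
  refine (hD _ (fun k => ?_) h2).trans ?_
  · rw [le_div_iff₀ hT0]
    exact (le_initLen hT2).trans (Nat.cast_le.2 (Nat.le_add_right _ _))
  · rw [mul_assoc]
    refine mul_le_mul_of_nonneg_left ?_ hD0
    -- The square of `1 / T` is at most `1 / T`, so rounding errors stay of the order of the unused
    -- fraction.
    have h4 : (e + 1 / T) ^ 2 ≤ 2 * (e ^ 2 + 1 / T) := by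
      have h5 : 1 / (T : ℝ) ≤ 1 := by
        rw [div_le_one hT0]; exact_mod_cast hT
      have h6 : 0 < 1 / (T : ℝ) := by positivity
      nlinarith [sq_nonneg (e - 1 / T)]
    have h7 : ∑ k, ((numPulls (qExp p) (initLen K (qExp p) a σ T) T x k : ℝ) / T
        - weight (qExp p) s k) ^ 2 ≤ K * (2 * C ^ 2) * (e ^ 2 + 1 / T) := by
      calc _ ≤ ∑ _k : Fin K, 2 * C ^ 2 * (e ^ 2 + 1 / T) := Finset.sum_le_sum fun k _ => by
            calc _ ≤ (C * (e + 1 / T)) ^ 2 :=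
                  sq_le_sq' (abs_le.1 (h1 k)).1 (abs_le.1 (h1 k)).2
              _ = C ^ 2 * (e + 1 / T) ^ 2 := mul_pow _ _ _
              _ ≤ C ^ 2 * (2 * (e ^ 2 + 1 / T)) := by gcongr
              _ = _ := by ring
        _ = _ := by simp; ring
    linarith

/-- With one arm `λ = 1`, so phase 1 already uses all `T` rounds. -/
lemma gap_of_one (p : ℝ≥0∞) {s : Fin 1 → ℝ} (hs : ∀ k, 0 < s k) {a : ℝ} (ha : 0 < a) (σ : ℝ)
    (T : ℕ) (x : Fin 1 → ℕ → ℝ) : gap p s a σ T x = 0 := by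
  have h1 : initLen 1 (qExp p) a σ T = T := by
    have := (Real.rpow_pos_of_pos ha (qExp p)).ne'
    simp [initLen, initFrac, this]
  have h2 : ∀ k, weight (qExp p) s k = 1 := fun k => by
    have := sum_weight (powSum_pos hs (qExp p)).ne'
    rw [Fin.sum_univ_one] at this
    rwa [Subsingleton.elim k 0]
  have h3 : optAlloc p s T = fun _ => (T : ℝ) := by
    ext k; rw [optAlloc, h2, one_mul]
  have h4 : ∀ k, numPulls (qExp p) T T x k = T := fun k => by
    unfold numPulls; simp
  unfold gap
  rw [h1, h3]
  simp_rw [h4]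
  exact sub_self _

lemma measurable_request (q : ℝ) (τ T : ℕ) (k : Fin K) :
    Measurable fun x : Fin K → ℕ → ℝ => request q τ T x k := by
  have hr : ∀ j, Measurable fun x : Fin K → ℕ → ℝ => √(sampleVar (x j) τ) ^ q := fun j =>
    ((measurable_sampleVar τ).comp (measurable_pi_apply j)).sqrt.pow_const q
  have hw : Measurable fun x : Fin K → ℕ → ℝ => estWeight q τ x k * T := by
    unfold estWeight weight powSum
    exact ((hr k).div (Finset.measurable_sum _ fun j _ => hr j)).mul_const _
  exact (measurable_from_top (f := fun n : ℕ => n - τ)).comp (Nat.measurable_floor.comp hw)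

/-- The observations enter only through the vector of requests, which takes values in a discrete
space. -/
lemma measurable_gap (p : ℝ≥0∞) (s : Fin K → ℝ) (a σ : ℝ) (T : ℕ) :
    Measurable (gap p s a σ T) := by
  set τ := initLen K (qExp p) a σ T with hτ
  have h1 : Measurable fun (x : Fin K → ℕ → ℝ) k => request (qExp p) τ T x k :=
    measurable_pi_lambda _ fun k => measurable_request _ _ _ k
  exact (Measurable.of_discrete (f := fun r : Fin K → ℕ => objective p s
    (fun k => ((τ + min (r k) (T - K * τ - ∑ j ∈ Finset.Iio k, r j) : ℕ) : ℝ))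
      - objective p s (optAlloc p s T))).comp h1

/-- For fixed `T` only finitely many vectors of counts can occur; this also covers zero counts,
where division returns `0`. -/
lemma exists_abs_gap_le (p : ℝ≥0∞) (s : Fin K → ℝ) (a σ : ℝ) (T : ℕ) :
    ∃ C : ℝ, ∀ x : Fin K → ℕ → ℝ, |gap p s a σ T x| ≤ C := by
  set τ := initLen K (qExp p) a σ T with hτ
  have hfin : (Set.Iic (fun _ : Fin K => τ + T)).Finite := Set.finite_Iic _
  obtain ⟨C, hC⟩ := (hfin.image fun n : Fin K → ℕ =>
    |objective p s (fun k => (n k : ℝ)) - objective p s (optAlloc p s T)|).bddAbove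
  refine ⟨C, fun x => hC ⟨numPulls (qExp p) τ T x, fun k => ?_, rfl⟩⟩
  change numPulls (qExp p) τ T x k ≤ τ + T
  unfold numPulls
  omega

lemma minVar_le (s : Fin K → ℝ) (k : Fin K) : minVar s ≤ s k ^ 2 :=
  ciInf_le (f := fun k => s k ^ 2) (Set.finite_range _).bddBelow k

lemma minVar_lt_powSum_two (hK : 2 ≤ K) {s : Fin K → ℝ} (hs : ∀ k, 0 < s k) :
    minVar s < powSum s 2 := by
  refine (minVar_le s ⟨0, by omega⟩).trans_lt ?_
  unfold powSum
  simp only [Real.rpow_two]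
  exact Finset.single_lt_sum (i := (⟨0, by omega⟩ : Fin K))
    (j := ⟨1, by omega⟩) (by simp)
    (Finset.mem_univ _) (Finset.mem_univ _) (pow_pos (hs _) 2) fun k _ _ => sq_nonneg _

end Gap

/-! ### Expected gap. -/

section Expectation
variable {Ω : Type*} [MeasurableSpace Ω] {μ : Measure Ω} [IsProbabilityMeasure μ] {K : ℕ}
  {P : Fin K → Measure ℝ} [∀ k, IsProbabilityMeasure (P k)] {X : Fin K → ℕ → Ω → ℝ}

lemma integrable_gap (hX : ∀ k t, AEMeasurable (X k t) μ) (p : ℝ≥0∞) (s : Fin K → ℝ) (a σ : ℝ)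
    (T : ℕ) : Integrable (fun ω => gap p s a σ T (fun k t => X k t ω)) μ := by
  obtain ⟨C, hC⟩ := exists_abs_gap_le p s a σ T
  have hx : AEMeasurable (fun ω k t => X k t ω) μ :=
    aemeasurable_pi_lambda _ fun k => aemeasurable_pi_lambda _ fun t => hX k t
  exact Integrable.of_bound
    ((measurable_gap p s a σ T).comp_aemeasurable hx).aestronglyMeasurable C
    (ae_of_all _ fun ω => hC _)

/-- The total mean squared error of the sample variances after the initial phase is `O(1 / T)`. -/
lemma exists_integral_sum_sampleVar_sub_sq_le {σ : ℝ≥0} (hσ : ∀ k, IsSubgaussian (P k) σ)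
    (hlaw : ∀ k t, HasLaw (X k t) (P k) μ) (hindep : ∀ k, iIndepFun (X k) μ) {q a s : ℝ}
    (hlam : 0 < initFrac K q a s) :
    ∃ C : ℝ, 0 ≤ C ∧ ∀ T : ℕ, 4 ≤ initFrac K q a s * T →
      Integrable (fun ω => ∑ k, (sampleVar (fun t => X k t ω) (initLen K q a s T)
        - Var[id; P k]) ^ 2) μ ∧
      ∫ ω, ∑ k, (sampleVar (fun t => X k t ω) (initLen K q a s T) - Var[id; P k]) ^ 2 ∂μ
        ≤ C / T := by
  choose C hC0 hC using fun k =>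
    exists_integral_sampleVar_sub_sq_le (hσ k) (hlaw k) (hindep k)
  refine ⟨∑ k, C k / (initFrac K q a s / 2),
    Finset.sum_nonneg fun k _ => div_nonneg (hC0 k) (by positivity), fun T hT => ?_⟩
  have h1 := le_initLen (K := K) (q := q) (a := a) (σ := s) (T := T) (by linarith)
  -- The threshold `4` makes `τ ≥ 2`, as the sample variance estimate requires.
  have h2 : 2 ≤ initLen K q a s T := by
    have : (2 : ℝ) ≤ initLen K q a s T := by linarith
    exact_mod_cast this
  have hT0 : (0 : ℝ) < T := by
    by_contra h
    nlinarith [(Nat.cast_nonneg T : (0 : ℝ) ≤ T)]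
  refine ⟨integrable_finsetSum _ fun k _ => (hC k _ h2).1, ?_⟩
  rw [integral_finsetSum _ fun k _ => (hC k _ h2).1, Finset.sum_div]
  refine Finset.sum_le_sum fun k _ => (hC k _ h2).2.trans ?_
  rw [div_div]
  exact div_le_div_of_nonneg_left (hC0 k) (by positivity) h1

variable {σ : ℝ≥0} {a : ℝ}

lemma le_stdDev {Q : Measure ℝ} (h : a ^ 2 ≤ Var[id; Q]) : a ≤ stdDev Q :=
  Real.le_sqrt_of_sq_le h

lemma stdDev_le {Q : Measure ℝ} [IsProbabilityMeasure Q] (h : IsSubgaussian Q σ) :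
    stdDev Q ≤ σ :=
  Real.sqrt_le_iff.2 ⟨σ.2, variance_le_of_isSubgaussian h⟩

lemma stdDev_sq (Q : Measure ℝ) : stdDev Q ^ 2 = Var[id; Q] :=
  Real.sq_sqrt (variance_nonneg _ _)

lemma eventually_le_mul_natCast {lam : ℝ} (hlam : 0 < lam) (b : ℝ) :
    ∀ᶠ T : ℕ in atTop, b ≤ lam * T :=
  (tendsto_natCast_atTop_atTop.const_mul_atTop hlam).eventually_ge_atTop b

/-- For `p = ∞` the expected gap is `O(T ^ (-3 / 2))`. -/
lemma exists_integral_gap_top_le [NeZero K] (hσ : ∀ k, IsSubgaussian (P k) σ) (ha : 0 < a)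
    (hlow : ∀ k, a ^ 2 ≤ Var[id; P k]) (hlaw : ∀ k t, HasLaw (X k t) (P k) μ)
    (hindep : ∀ k, iIndepFun (X k) μ) :
    ∃ C : ℝ, ∀ᶠ T : ℕ in atTop,
      ∫ ω, gap ∞ (fun k => stdDev (P k)) a σ T (fun k t => X k t ω) ∂μ
        ≤ C * (T : ℝ) ^ (-(3 / 2) : ℝ) := by
  have hK : 1 ≤ K := Nat.one_le_iff_ne_zero.2 (NeZero.ne K)
  have hlam : 0 < initFrac K (qExp ∞) a σ := initFrac_pos hK ha σ.2
  obtain ⟨C, hC0, hC⟩ := exists_gap_top_le (s := fun k => stdDev (P k)) ha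
    (fun k => le_stdDev (hlow k)) (fun k => stdDev_le (hσ k))
  obtain ⟨D, hD0, hD⟩ := exists_integral_sum_sampleVar_sub_sq_le hσ hlaw hindep hlam
  refine ⟨C * (D + 2), ?_⟩
  filter_upwards [eventually_le_mul_natCast hlam 4, eventually_ge_atTop 1] with T hT4 hT1
  have hT0 : (0 : ℝ) < T := by exact_mod_cast hT1
  have hT1r : (1 : ℝ) ≤ T := by exact_mod_cast hT1
  obtain ⟨hDi, hDle⟩ := hD T hT4
  set E : Ω → ℝ := fun ω => ∑ k, (sampleVar (fun t => X k t ω) (initLen K (qExp ∞) a σ T)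
        - Var[id; P k]) ^ 2 with hE
  have hr0 : 0 < √(T : ℝ) := Real.sqrt_pos.2 hT0
  have hr1 : 1 ≤ √(T : ℝ) := Real.one_le_sqrt.2 hT1r
  have hrr : √(T : ℝ) * √T = T := Real.mul_self_sqrt hT0.le
  have hpt : ∀ ω, gap ∞ (fun k => stdDev (P k)) a σ T (fun k t => X k t ω)
      ≤ C / T * (√T * E ω + 2 / √T) := by
    intro ω
    refine (hC T (fun k t => X k t ω) hT1 (by linarith)).trans ?_
    have hn := norm_sq_le_sum_sq ((fun k => sampleVar (fun t => X k t ω)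
      (initLen K (qExp ∞) a σ T)) - fun k => stdDev (P k) ^ 2)
    simp only [Pi.sub_apply, stdDev_sq] at hn ⊢
    set e := ‖(fun k => sampleVar (fun t => X k t ω)
      (initLen K (qExp ∞) a σ T)) - fun k => Var[id; P k]‖
    -- The factor `√T` balances the two terms: since `E e² = O(1/T)`, both have expectation `O(T ^
    -- (-1/2))`.
    have h1 : e ≤ √T * e ^ 2 + 1 / √T := by
      have h2 : √T * e ^ 2 + 1 / √T - e = ((√T * e - 1 / 2) ^ 2 + 3 / 4) / √T := by
        field_simp
        ring
      have h3 : 0 ≤ ((√T * e - 1 / 2) ^ 2 + 3 / 4) / √(T : ℝ) := by positivity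
      linarith
    have h4 : 1 / (T : ℝ) ≤ 1 / √T := by
      refine one_div_le_one_div_of_le hr0 ?_
      nlinarith
    have h5 : √T * e ^ 2 ≤ √T * E ω := by gcongr
    have h6 : 2 / √(T : ℝ) = 1 / √T + 1 / √T := by ring
    exact mul_le_mul_of_nonneg_left (by linarith) (by positivity)
  have hdom : Integrable (fun ω => C / T * (√T * E ω + 2 / √T)) μ :=
    ((hDi.const_mul _).add (integrable_const _)).const_mul _
  have hTpow : (T : ℝ) ^ (-(3 / 2) : ℝ) = 1 / (T * √T) := by
    rw [Real.rpow_neg hT0.le, show (3 / 2 : ℝ) = 1 + 1 / 2 by norm_num, Real.rpow_add hT0,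
      Real.rpow_one, ← Real.sqrt_eq_rpow, one_div]
  calc ∫ ω, gap ∞ (fun k => stdDev (P k)) a σ T (fun k t => X k t ω) ∂μ
      ≤ ∫ ω, C / T * (√T * E ω + 2 / √T) ∂μ :=
        integral_mono (integrable_gap (fun k t => (hlaw k t).aemeasurable) _ _ _ _ _) hdom hpt
    _ = C / T * (√T * ∫ ω, E ω ∂μ + 2 / √T) := by
        rw [integral_const_mul, integral_add (hDi.const_mul _) (integrable_const _),
          integral_const_mul]
        simp
    _ ≤ C / T * (√T * (D / T) + 2 / √T) := by gcongr
    _ = C * (D + 2) * (T : ℝ) ^ (-(3 / 2) : ℝ) := by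
        have h7 : √(T : ℝ) * (D / T) = D / √T := by
          rw [← hrr]; simp only [Real.sqrt_mul_self hr0.le]; field_simp
        rw [hTpow, h7]
        field_simp

/-- For `p < ∞` the expected gap is `O(T ^ (-2))`. -/
lemma exists_integral_gap_le [NeZero K] {p : ℝ≥0∞} (hp : p ≠ 0) (hpt : p ≠ ∞)
    (hσ : ∀ k, IsSubgaussian (P k) σ) (ha : 0 < a)
    (hlow : ∀ k, a ^ 2 ≤ Var[id; P k]) (hlaw : ∀ k t, HasLaw (X k t) (P k) μ)
    (hindep : ∀ k, iIndepFun (X k) μ) :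
    ∃ C : ℝ, ∀ᶠ T : ℕ in atTop,
      ∫ ω, gap p (fun k => stdDev (P k)) a σ T (fun k t => X k t ω) ∂μ
        ≤ C * (T : ℝ) ^ (-2 : ℝ) := by
  have hK : 1 ≤ K := Nat.one_le_iff_ne_zero.2 (NeZero.ne K)
  have hlam : 0 < initFrac K (qExp p) a σ := initFrac_pos hK ha σ.2
  obtain ⟨C, hC0, hC⟩ := exists_gap_le hp hpt (s := fun k => stdDev (P k)) ha
    (fun k => le_stdDev (hlow k)) (fun k => stdDev_le (hσ k))
  obtain ⟨D, hD0, hD⟩ := exists_integral_sum_sampleVar_sub_sq_le hσ hlaw hindep hlam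
  refine ⟨C * (D + 1), ?_⟩
  filter_upwards [eventually_le_mul_natCast hlam 4, eventually_ge_atTop 1] with T hT4 hT1
  have hT0 : (0 : ℝ) < T := by exact_mod_cast hT1
  obtain ⟨hDi, hDle⟩ := hD T hT4
  set E : Ω → ℝ := fun ω => ∑ k, (sampleVar (fun t => X k t ω) (initLen K (qExp p) a σ T)
        - Var[id; P k]) ^ 2 with hE
  have hbd : ∀ ω, gap p (fun k => stdDev (P k)) a σ T (fun k t => X k t ω)
      ≤ C / T * (E ω + 1 / T) := by
    intro ω
    refine (hC T (fun k t => X k t ω) hT1 (by linarith)).trans ?_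
    have hn := norm_sq_le_sum_sq ((fun k => sampleVar (fun t => X k t ω)
      (initLen K (qExp p) a σ T)) - fun k => stdDev (P k) ^ 2)
    simp only [Pi.sub_apply, stdDev_sq] at hn ⊢
    gcongr
  have hdom : Integrable (fun ω => C / T * (E ω + 1 / T)) μ :=
    (hDi.add (integrable_const _)).const_mul _
  calc ∫ ω, gap p (fun k => stdDev (P k)) a σ T (fun k t => X k t ω) ∂μ
      ≤ ∫ ω, C / T * (E ω + 1 / T) ∂μ :=
        integral_mono (integrable_gap (fun k t => (hlaw k t).aemeasurable) _ _ _ _ _) hdom hbd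
    _ = C / T * (∫ ω, E ω ∂μ + 1 / T) := by
        rw [integral_const_mul, integral_add hDi (integrable_const _)]
        simp
    _ ≤ C / T * (D / T + 1 / T) := by gcongr
    _ = C * (D + 1) * (T : ℝ) ^ (-2 : ℝ) := by
        rw [Real.rpow_neg hT0.le, Real.rpow_two]
        field_simp

end Expectation

/-! ### Absorbing the constants into the logarithm. -/

lemma tendsto_log_natCast_atTop : Tendsto (fun T : ℕ => Real.log T) atTop atTop :=
  Real.tendsto_log_atTop.comp tendsto_natCast_atTop_atTop

end MultiGroupMean

theorem mainTheorem8 {Ω : Type*} [MeasurableSpace Ω] (μ : Measure Ω) [IsProbabilityMeasure μ]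
    (K : ℕ) (hK : 1 ≤ K)
    (P : Fin K → Measure ℝ) [∀ k, IsProbabilityMeasure (P k)]
    (σ : ℝ≥0) (hσ : ∀ k, MultiGroupMean.IsSubgaussian (P k) σ)
    (hstrict : ∀ k, MultiGroupMean.IsStrictlySubgaussian (P k))
    (a : ℝ) (ha : 0 < a) (hlow : ∀ k, a ^ 2 ≤ Var[id; P k])
    (X : Fin K → ℕ → Ω → ℝ)
    (hlaw : ∀ k t, HasLaw (X k t) (P k) μ)
    (hindep : ∀ k, iIndepFun (X k) μ)
    (p : ℝ≥0∞) (hp : p ≠ 0) :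
    let s : Fin K → ℝ := fun k => MultiGroupMean.stdDev (P k)
    let q : ℝ := MultiGroupMean.qExp p
    let lam : ℝ := MultiGroupMean.initFrac K q a σ
    let G : ℕ → Ω → ℝ := fun T ω => MultiGroupMean.gap p s a σ T (fun k t => X k t ω)
    (∀ T : ℕ, Integrable (G T) μ) ∧
    (p = ∞ → ∃ r : ℕ → ℝ, r =o[atTop] (fun T : ℕ => (T : ℝ) ^ (-(3 / 2) : ℝ)) ∧
      ∀ᶠ T : ℕ in atTop,
        ∫ ω, G T ω ∂μ ≤
          4 * lam ^ (-(1 / 2) : ℝ) * (MultiGroupMean.powSum s 2 - MultiGroupMean.minVar s)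
            * (T : ℝ) ^ (-(3 / 2) : ℝ) * √(Real.log T) + r T) ∧
    (p ≠ ∞ → ∃ r : ℕ → ℝ, r =o[atTop] (fun T : ℕ => (T : ℝ) ^ (-2 : ℝ)) ∧
      ∀ᶠ T : ℕ in atTop,
        ∫ ω, G T ω ∂μ ≤
          3 * p.toReal ^ 2 * MultiGroupMean.powSum s q ^ (2 / q) / (lam * (p.toReal + 1))
            * (T : ℝ) ^ (-2 : ℝ) * Real.log T + r T) := by
  intro s q lam G
  have : NeZero K := ⟨by omega⟩
  have hs : ∀ k, 0 < s k := fun k => ha.trans_le (MultiGroupMean.le_stdDev (hlow k))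
  have hlam : 0 < lam := MultiGroupMean.initFrac_pos hK ha σ.2
  refine ⟨MultiGroupMean.integrable_gap (fun k t => (hlaw k t).aemeasurable) p s a σ, ?_, ?_⟩
  · rintro rfl
    refine ⟨fun _ => 0, isLittleO_zero _ _, ?_⟩
    -- For `K = 1` the coefficient `Σ₂ - σ_min²` is zero and absorbs nothing; for `K ≥ 2` it is
    -- positive.
    rcases hK.eq_or_lt with rfl | hK2
    · have hG : ∀ T ω, G T ω = 0 := fun T ω => MultiGroupMean.gap_of_one ∞ hs ha σ T _
      refine Eventually.of_forall fun T => ?_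
      have h1 : MultiGroupMean.powSum s 2 = s 0 ^ 2 := by
        simp [MultiGroupMean.powSum]
      have h2 := sub_nonneg.2 (h1 ▸ MultiGroupMean.minVar_le s 0)
      simp only [hG, integral_zero, add_zero]
      have h3 := Real.rpow_nonneg hlam.le (-(1 / 2))
      exact mul_nonneg (mul_nonneg (mul_nonneg (mul_nonneg (by norm_num) h3) h2)
        (Real.rpow_nonneg (Nat.cast_nonneg T) _)) (Real.sqrt_nonneg _)
    · obtain ⟨C, hC⟩ := MultiGroupMean.exists_integral_gap_top_le hσ ha hlow hlaw hindep
      set c : ℝ := 4 * lam ^ (-(1 / 2) : ℝ)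
        * (MultiGroupMean.powSum s 2 - MultiGroupMean.minVar s) with hc
      have hc0 : 0 < c := mul_pos (mul_pos (by norm_num) (Real.rpow_pos_of_pos hlam _))
        (sub_pos.2 (MultiGroupMean.minVar_lt_powSum_two hK2 hs))
      filter_upwards [hC, ((Real.tendsto_sqrt_atTop.comp
        MultiGroupMean.tendsto_log_natCast_atTop).const_mul_atTop hc0).eventually_ge_atTop C]
        with T hT hT2
      refine hT.trans ?_
      rw [add_zero, mul_right_comm]
      exact mul_le_mul_of_nonneg_right hT2 (Real.rpow_nonneg (Nat.cast_nonneg T) _)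
  · intro hpt
    refine ⟨fun _ => 0, isLittleO_zero _ _, ?_⟩
    obtain ⟨C, hC⟩ := MultiGroupMean.exists_integral_gap_le hp hpt hσ ha hlow hlaw hindep
    have hp0 : 0 < p.toReal := ENNReal.toReal_pos hp hpt
    set c : ℝ := 3 * p.toReal ^ 2 * MultiGroupMean.powSum s q ^ (2 / q)
      / (lam * (p.toReal + 1)) with hc
    have hc0 : 0 < c := by
      have := Real.rpow_pos_of_pos (MultiGroupMean.powSum_pos hs q) (2 / q)
      positivity
    filter_upwards [hC, (MultiGroupMean.tendsto_log_natCast_atTop.const_mul_atTop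
      hc0).eventually_ge_atTop C] with T hT hT2
    refine hT.trans ?_
    rw [add_zero, mul_right_comm]
    exact mul_le_mul_of_nonneg_right hT2 (Real.rpow_nonneg (Nat.cast_nonneg T) _)
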